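/- **Proposition.** Let $M$ be a smooth manifold and $F$ a smooth foliation of codimension $q$ on $M$ that is transversely affine: $M$ is covered by foliation charts between which the transverse coordinate changes are locally affine maps of $\mathbb{R}^q$. (1) Let $T\subset M$ be a transversal of $F$ (an embedded submanifold with $TM|_T = TT\oplus TF$) with a global coordinate system $x=(x_1,\dots,x_q)\colon T\to\mathbb{R}^q$ (a diffeomorphism onto an open set) with respect to which the holonomy maps of $F$ between open subsets of $T$ are locally affine. Let $G_T$ be the étale groupoid of holonomy germs between points of $T$ (the restriction to $T$ of the holonomy groupoid of $F$), with source $s$ and range $r$, and let $C_c^\infty(G_T)$ be its space of smooth compactly supported functions (the linear span of the smooth functions compactly supported in a coordinate neighbourhood of $G_T$). For $\gamma\in G_T$ let $\delta(\gamma)=|\det d\gamma|$ be the Jacobian, in the coordinates $x$, of the germ $\gamma$ at $s(\gamma)$, and for $t\in\mathbb{R}$ put $$\sigma_t(f)(\gamma)=\delta(\gamma)^{it}f(\gamma).$$ For $f^0,\dots,f^q\in C_c^\infty(G_T)$ let $$\phi(f^0,\dots,f^q)=\int_{\gamma_0\cdots\gamma_q\in T} f^0(\gamma_0)\,df^1(\gamma_1)\wedge\dots\wedge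 df^q(\gamma_q),$$ that is, the integral over $T$, oriented by $x$, of the $q$-form whose value at a point $y$ is the sum of $f^0(\gamma_0)\,df^1(\gamma_1)\wedge\dots\wedge df^q(\gamma_q)$ over all composable $(\gamma_0,\dots,\gamma_q)$ whose product is the unit at $y$; here the manifold of such tuples is étale over $T$, and each $df^j(\gamma_j)$ is the differential at $y$ of the resulting function on a neighbourhood of $y$ in $T$. Then $\sigma_t$ maps $C_c^\infty(G_T)$ to itself, the sum above has only finitely many nonzero terms at each point, its integral converges absolutely, and $$\phi(\sigma_t f^0,\dots,\sigma_t f^q)=\phi(f^0,\dots,f^q)$$ for all $f^0,\dots,f^q\in C_c^\infty(G_T)$ and all $t\in\mathbb{R}$. (2) If $q=1$, the Godbillon–Vey class of $F$ vanishes in $H^3(M;\mathbb{R})$: for all smooth $1$-forms $\omega,\eta$ on $M$ with $\ker\omega=TF$ and $d\omega=\eta\wedge\omega$, the $3$-form $\eta\wedge d\eta$ is exact. -/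

import Mathlib

open Filter Topology MeasureTheory Set
open scoped Manifold ContDiff

/-- `ℝⁿ`. -/
abbrev Eucl (n : ℕ) : Type := EuclideanSpace ℝ (Fin n)

/-- The model space `ℝᵖ × ℝ^q` of a manifold of dimension `p + q` with a foliation of
dimension `p` and codimension `q`; the plaques are the slices `ℝᵖ × {y}`. -/
abbrev FolModel (p q : ℕ) : Type := Eucl p × Eucl q

/-- A smooth foliation of dimension `p` and codimension `q` on `M`, given by a foliated atlas:
smooth charts into `ℝᵖ × ℝ^q` covering `M` whose coordinate changes are locally of the form
`(x, y) ↦ (g₁ (x, y), g₂ y)`. -/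
structure Foliation (p q : ℕ) (M : Type*) [TopologicalSpace M] [ChartedSpace (FolModel p q) M] where
  atlas : Set (OpenPartialHomeomorph M (FolModel p q))
  smooth : atlas ⊆ IsManifold.maximalAtlas 𝓘(ℝ, FolModel p q) ∞ M
  cover : ∀ x : M, ∃ e ∈ atlas, x ∈ e.source
  compatible : ∀ e ∈ atlas, ∀ e' ∈ atlas, ∀ z ∈ (e.symm.trans e').source,
    ∃ g : Eucl q → Eucl q, ∀ᶠ w in 𝓝 z, (e' (e.symm w)).2 = g w.2

namespace Foliation

variable {p q : ℕ} {M : Type*} [TopologicalSpace M] [ChartedSpace (FolModel p q) M]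

/-- A foliation chart of `F`: a smooth chart whose transverse coordinates are related to those of
the given foliated atlas by local maps of `ℝ^q`, in both directions. -/
def IsFoliationChart (F : Foliation p q M) (e : OpenPartialHomeomorph M (FolModel p q)) : Prop :=
  e ∈ IsManifold.maximalAtlas 𝓘(ℝ, FolModel p q) ∞ M ∧
  ∀ e' ∈ F.atlas,
    (∀ z ∈ (e.symm.trans e').source,
      ∃ g : Eucl q → Eucl q, ∀ᶠ w in 𝓝 z, (e' (e.symm w)).2 = g w.2) ∧
    (∀ z ∈ (e'.symm.trans e).source,
      ∃ g : Eucl q → Eucl q, ∀ᶠ w in 𝓝 z, (e (e'.symm w)).2 = g w.2)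

/-- `F` is transversely affine: `M` is covered by foliation charts between which the transverse
coordinate changes are (locally) affine maps of `ℝ^q`. -/
def TransverselyAffine (F : Foliation p q M) : Prop :=
  ∃ 𝒜 : Set (OpenPartialHomeomorph M (FolModel p q)),
    (∀ e ∈ 𝒜, F.IsFoliationChart e) ∧
    (∀ x : M, ∃ e ∈ 𝒜, x ∈ e.source) ∧
    ∀ e ∈ 𝒜, ∀ e' ∈ 𝒜, ∀ z ∈ (e.symm.trans e').source,
      ∃ A : Eucl q →ᵃ[ℝ] Eucl q, ∀ᶠ w in 𝓝 z, (e' (e.symm w)).2 = A w.2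

/-- The tangent space at `x` to the leaf of `F` through `x`: the kernel of the derivative of the
transverse coordinate of any chart of the foliated atlas at `x`. -/
noncomputable def tangent (F : Foliation p q M) (x : M) :
    Submodule ℝ (TangentSpace 𝓘(ℝ, FolModel p q) x) :=
  ⨅ e ∈ F.atlas, ⨅ _ : x ∈ e.source,
    LinearMap.ker ((ContinuousLinearMap.snd ℝ (Eucl p) (Eucl q)).comp
      (mfderiv 𝓘(ℝ, FolModel p q) 𝓘(ℝ, FolModel p q) e x)).toLinearMap

/-- `c : [0, 1] → M` is a path in a leaf: it is continuous, and in each chart of the foliated atlas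
its transverse coordinate is locally constant. -/
def IsLeafPath (F : Foliation p q M) (c : ℝ → M) : Prop :=
  ContinuousOn c (Icc 0 1) ∧
  ∀ t ∈ Icc (0 : ℝ) 1, ∀ e ∈ F.atlas, c t ∈ e.source →
    ∀ᶠ t' in 𝓝[Icc 0 1] t, (e (c t')).2 = (e (c t)).2

/-- A transversal `T ⊆ M` of `F` together with a global coordinate system `x : T → ℝ^q`. It is
recorded by the open set `domain = x(T)` and the map `param = x⁻¹ : x(T) → M`, which is a smooth
embedding with image `T` and transverse to `F`; points of `T` are denoted by their coordinates. -/
structure Transversal (F : Foliation p q M) where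
  domain : Set (Eucl q)
  isOpen_domain : IsOpen domain
  param : Eucl q → M
  isEmbedding : IsEmbedding (domain.domRestrict param)
  smooth : ContMDiffOn 𝓘(ℝ, Eucl q) 𝓘(ℝ, FolModel p q) ∞ param domain
  transverse : ∀ u ∈ domain,
    IsCompl (LinearMap.range
      (mfderiv 𝓘(ℝ, Eucl q) 𝓘(ℝ, FolModel p q) param u).toLinearMap) (F.tangent (param u))

namespace Transversal

variable {F : Foliation p q M}

/-- `h` is, in the coordinates `x`, a holonomy map between open subsets of `T`: each point `v` of
its domain is joined to `h v` by a path in its leaf, and these paths depend continuously on `v`. -/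
def IsHolonomyMap (T : F.Transversal) (h : OpenPartialHomeomorph (Eucl q) (Eucl q)) : Prop :=
  h.source ⊆ T.domain ∧ h.target ⊆ T.domain ∧
  ∃ H : ℝ × Eucl q → M,
    ContinuousOn H (Icc (0 : ℝ) 1 ×ˢ h.source) ∧
    ∀ v ∈ h.source, H (0, v) = T.param v ∧ H (1, v) = T.param (h v) ∧
      F.IsLeafPath (fun t => H (t, v))

/-- `x` is an affine transverse coordinate on `T`: with respect to it the holonomy maps of `F`
restricted to `T` are (locally) affine. -/
def IsAffine (T : F.Transversal) : Prop :=
  ∀ h, T.IsHolonomyMap h → ∀ v ∈ h.source,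
    ∃ A : Eucl q →ᵃ[ℝ] Eucl q, (h : Eucl q → Eucl q) =ᶠ[𝓝 v] A

/-- The holonomy groupoid `G_T` of `F` restricted to `T`. An element of the holonomy groupoid is a
leafwise path up to equality of the holonomy germs; with both end points on `T` it is a germ of a
holonomy map of `T`. -/
@[ext]
structure Arrow (T : F.Transversal) where
  /-- the source `s γ` -/
  src : Eucl q
  /-- the holonomy germ at the source -/
  germ : Germ (𝓝 src) (Eucl q)
  isHol : ∃ h : OpenPartialHomeomorph (Eucl q) (Eucl q),
    T.IsHolonomyMap h ∧ src ∈ h.source ∧ germ = ((h : Eucl q → Eucl q) : Germ (𝓝 src) (Eucl q))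

/-- The element of `G_T` given by the germ of the holonomy map `h` at `v`. -/
def arrowOf {T : F.Transversal} {h : OpenPartialHomeomorph (Eucl q) (Eucl q)}
    (hh : T.IsHolonomyMap h) {v : Eucl q} (hv : v ∈ h.source) : T.Arrow :=
  ⟨v, ((h : Eucl q → Eucl q) : Germ (𝓝 v) (Eucl q)), h, hh, hv, rfl⟩

namespace Arrow

variable {T : F.Transversal}

/-- The range `r γ`. -/
def tgt (γ : T.Arrow) : Eucl q := γ.germ.value

/-- Some holonomy map with germ `γ`; everything below depends on its germ at `γ.src` only. -/
noncomputable def rep (γ : T.Arrow) : OpenPartialHomeomorph (Eucl q) (Eucl q) := γ.isHol.choose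

theorem rep_isHolonomyMap (γ : T.Arrow) : T.IsHolonomyMap γ.rep := γ.isHol.choose_spec.1

theorem src_mem_rep (γ : T.Arrow) : γ.src ∈ γ.rep.source := γ.isHol.choose_spec.2.1

theorem germ_eq_rep (γ : T.Arrow) :
    γ.germ = ((γ.rep : Eucl q → Eucl q) : Germ (𝓝 γ.src) (Eucl q)) := γ.isHol.choose_spec.2.2

/-- `δ(γ) = dγ/dx`: the factor by which the holonomy germ `γ` changes the density on `T` given by
the volume form of the coordinate system `x`. -/
noncomputable def delta (γ : T.Arrow) : ℝ :=
  |LinearMap.det (fderiv ℝ γ.rep γ.src).toLinearMap|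

open Classical in
/-- A function `f` on the étale groupoid `G_T` read near `γ` in the coordinates of the source:
`v ↦ f (γ_v)`, where `γ_v` is the element near `γ` with source `v`. -/
noncomputable def near (γ : T.Arrow) (f : T.Arrow → ℂ) (v : Eucl q) : ℂ :=
  if hv : v ∈ γ.rep.source then f (arrowOf γ.rep_isHolonomyMap hv) else 0

/-- The germ representative of the product `γ₁ γ₂ ⋯ γ_k` of a list of composable elements. -/
noncomputable def prodRep (l : List T.Arrow) : Eucl q → Eucl q :=
  l.foldr (fun γ g => γ.rep ∘ g) id

end Arrow

open Classical in
/-- The function on `G_T` that equals the function `g` (in the source coordinate) on the open set of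
germs of `h`, and vanishes elsewhere. -/
noncomputable def bump (T : F.Transversal) (h : OpenPartialHomeomorph (Eucl q) (Eucl q))
    (g : Eucl q → ℂ) (γ : T.Arrow) : ℂ :=
  if γ.src ∈ h.source ∧ γ.germ = ((h : Eucl q → Eucl q) : Germ (𝓝 γ.src) (Eucl q))
    then g γ.src else 0

/-- `C_c^∞(G_T)`: the linear span of the smooth functions with compact support in a coordinate
neighbourhood `{germs of h} ≅ h.source` of the étale groupoid `G_T`. -/
def smoothAlg (T : F.Transversal) : Submodule ℂ (T.Arrow → ℂ) :=
  Submodule.span ℂ {f | ∃ (h : OpenPartialHomeomorph (Eucl q) (Eucl q)) (g : Eucl q → ℂ),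
    T.IsHolonomyMap h ∧ ContDiff ℝ ∞ g ∧ HasCompactSupport g ∧ tsupport g ⊆ h.source ∧
    f = T.bump h g}

/-- The modular one-parameter group `σ_t(f)(γ) = δ(γ)^{it} f(γ)`. -/
noncomputable def modular (T : F.Transversal) (t : ℝ) (f : T.Arrow → ℂ) : T.Arrow → ℂ :=
  fun γ => (γ.delta : ℂ) ^ (Complex.I * t) * f γ

/-- `γ₀, …, γ_q` are composable (`s γ_j = r γ_{j+1}`), `s γ_q = x`, and the product `γ₀ ⋯ γ_q` is
the unit of `G_T` at the point `x` of `T`. -/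
def IsLoop (T : F.Transversal) (x : Eucl q) (γ : Fin (q + 1) → T.Arrow) : Prop :=
  (γ (Fin.last q)).src = x ∧
  (∀ j : Fin q, (γ j.castSucc).src = (γ j.succ).tgt) ∧
  Arrow.prodRep (List.ofFn γ) =ᶠ[𝓝 x] id

/-- The differential at `x`, as a covector on `T`, of `df^j_{γ_j}`: the manifold of loops
`{γ₀ ⋯ γ_q ∈ T}` is étale over `T`, the loop over `v` near `x` has the `j`-th member
`γ_j` with source `(γ_{j+1} ⋯ γ_q)(v)`, and one differentiates `v ↦ f^j(γ_j)` at `v = x`. -/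
noncomputable def dLoop (T : F.Transversal) (x : Eucl q) (f : Fin (q + 1) → T.Arrow → ℂ)
    (γ : Fin (q + 1) → T.Arrow) (j : Fin (q + 1)) : Eucl q →L[ℝ] ℂ :=
  fderiv ℝ
    (fun v => (γ j).near (f j) (Arrow.prodRep ((List.ofFn γ).drop ((j : ℕ) + 1)) v)) x

/-- The coefficient of `dx₁ ∧ ⋯ ∧ dx_q` in
`f^0(γ₀) df^1(γ₁) ∧ ⋯ ∧ df^q(γ_q)` at the point `x` of `T`. -/
noncomputable def loopTerm (T : F.Transversal) (x : Eucl q) (f : Fin (q + 1) → T.Arrow → ℂ)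
    (γ : Fin (q + 1) → T.Arrow) : ℂ :=
  f 0 (γ 0) *
    (Matrix.of fun j i : Fin q => T.dLoop x f γ j.succ (EuclideanSpace.single i (1 : ℝ))).det

/-- The density on `T` obtained by summing over the loops `γ₀ ⋯ γ_q` at `x`. -/
noncomputable def loopSum (T : F.Transversal) (f : Fin (q + 1) → T.Arrow → ℂ) (x : Eucl q) : ℂ :=
  ∑ᶠ γ : {γ : Fin (q + 1) → T.Arrow // T.IsLoop x γ}, T.loopTerm x f γ.1

/-- The transverse fundamental cocycle
`φ(f^0, …, f^q) = ∫_{γ₀ ⋯ γ_q ∈ T} f^0(γ₀) df^1(γ₁) ∧ ⋯ ∧ df^q(γ_q)`,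
where `T` is oriented by the coordinate system `x`. -/
noncomputable def fundCocycle (T : F.Transversal) (f : Fin (q + 1) → T.Arrow → ℂ) : ℂ :=
  ∫ x in T.domain, T.loopSum f x

/-- The sum and the integral that define `φ(f^0, …, f^q)` make sense. -/
def FundCocycleDefined (T : F.Transversal) (f : Fin (q + 1) → T.Arrow → ℂ) : Prop :=
  (∀ x ∈ T.domain, {γ | T.IsLoop x γ ∧ T.loopTerm x f γ ≠ 0}.Finite) ∧
  IntegrableOn (T.loopSum f) T.domain

end Transversal

end Foliation

section Forms

variable {V : Type*} [NormedAddCommGroup V] [NormedSpace ℝ V]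
  {M : Type*} [TopologicalSpace M] [ChartedSpace V M]

variable (V M) in
/-- Real differential `k`-forms on `M` (without any regularity). -/
def MForm (k : ℕ) : Type _ := (x : M) → TangentSpace 𝓘(ℝ, V) x [⋀^Fin k]→L[ℝ] ℝ

namespace MForm

variable {k : ℕ}

/-- The expression of a form in a chart: its pullback by the inverse of the chart. -/
noncomputable def inChart (α : MForm V M k) (e : OpenPartialHomeomorph M V) (y : V) :
    V [⋀^Fin k]→L[ℝ] ℝ :=
  (α (e.symm y)).compContinuousLinearMap (mfderiv 𝓘(ℝ, V) 𝓘(ℝ, V) e.symm y)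

/-- Smoothness of a form, in the charts of `M`. -/
def IsSmooth (α : MForm V M k) : Prop :=
  ∀ c : M, ContDiffOn ℝ ∞ (α.inChart (chartAt V c)) (chartAt V c).target

/-- The exterior derivative, computed in the chart at each point. -/
noncomputable def d (α : MForm V M k) : MForm V M (k + 1) := fun x =>
  (extDeriv (α.inChart (chartAt V x)) (chartAt V x x)).compContinuousLinearMap
    (mfderiv 𝓘(ℝ, V) 𝓘(ℝ, V) (chartAt V x) x)

/-- The wedge product `α ∧ β` of a `1`-form and a `k`-form,
`(α ∧ β)(v₀, …, v_k) = ∑ᵢ (-1)ⁱ α(vᵢ) β(v₀, …, v̂ᵢ, …, v_k)`. -/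
noncomputable def wedge (α : MForm V M 1) (β : MForm V M k) : MForm V M (k + 1) := fun x =>
  ContinuousAlternatingMap.alternatizeUncurryFin
    (E := V)
    (((ContinuousAlternatingMap.ofSubsingleton ℝ V ℝ (0 : Fin 1)).symm (α x)).smulRight
      (show V [⋀^Fin k]→L[ℝ] ℝ from β x))

/-- The form is exact: its de Rham class vanishes. -/
def IsExact (θ : MForm V M (k + 1)) : Prop :=
  ∃ β : MForm V M k, β.IsSmooth ∧ β.d = θ

end MForm

end Forms

/-- `θ` is a closed `3`-form representing the Godbillon–Vey class of the codimension one foliation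
`F`: `θ = η ∧ dη`, where `F` is the kernel of a smooth `1`-form `ρ` and `η` is a smooth `1`-form
with `dρ = η ∧ ρ`. -/
def Foliation.IsGodbillonVeyForm {p : ℕ} {M : Type*} [TopologicalSpace M]
    [ChartedSpace (FolModel p 1) M] (F : Foliation p 1 M) (θ : MForm (FolModel p 1) M 3) : Prop :=
  ∃ ρ η : MForm (FolModel p 1) M 1, ρ.IsSmooth ∧ η.IsSmooth ∧
    (∀ (x : M) (v : TangentSpace 𝓘(ℝ, FolModel p 1) x), ρ x (fun _ => v) = 0 ↔ v ∈ F.tangent x) ∧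
    ρ.d = η.wedge ρ ∧ θ = η.wedge η.d

/-!
The two parts of the theorem rest on the same remark: if the holonomy of a foliation is locally
affine, the transverse Jacobian is locally constant.

**The fundamental cocycle.** A germ of an affine map is determined by its germs at nearby points
(`LocallyAffineAt.eventuallyEq_of_frequently`), so the holonomy groupoid `G_T` is Hausdorff and the
elements of `C_c^∞(G_T)` are differentiable near every arrow in the coordinate of the source
(`differentiableAt_near`). As `δ` is locally constant, `σ_t` multiplies a function and all its
differentials near an arrow `γ` by the constant `δ(γ)^{it}` (`near_modular_eventuallyEq`). Hence the
term of a loop `γ₀ ⋯ γ_q = x` is multiplied by `∏ δ(γ_j)^{it}`, and by the chain rule `∏ δ(γ_j)` is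
the Jacobian of the identity germ at `x`, which is `1` (`IsLoop.prod_delta`). That the cocycle is
well defined is checked on bump functions supported in coordinate neighbourhoods given by holonomy
maps `h₀, …, h_q` (`fundCocycleDefined_bump`): there is at most one nonzero term over each point,
and the sum is a continuous function restricted to the intersection of an open set, where `h₀ ∘ ⋯ ∘ h_q` is
locally the identity, with a compact set. Both properties extend to the span by multilinearity
(`fundCocycleDefined`).

**The Godbillon–Vey class.** Let `F = ker ρ` and `dρ = η ∧ ρ`. In a chart of the affine atlas with
transverse coordinate `y` one has `ρ = f dy` with `f ≠ 0`, and an affine change of `y` multiplies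
`f` by a locally constant factor. So `κ = d log |f|` is a globally defined closed form
(`logDerivForm_inChart`), and `dρ = κ ∧ ρ`. Therefore `(η - κ) ∧ ρ = 0`, which makes `η - κ` a
multiple of `ρ`; differentiating gives `ρ ∧ dη = 0`, thus `(η - κ) ∧ dη = 0` and
`η ∧ dη = κ ∧ dη = d (η ∧ κ)` (`extDeriv_wedgeAt_eq_of_closed`). The exterior derivative of a form
at a point is defined by the preferred chart at that point, and the argument only ever compares
derivatives at the centre of a preferred chart; identities between the forms themselves are carried
over to other points by pulling back.
-/

/-! ### Locally affine maps -/

section LocallyAffine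

variable {E : Type*} [NormedAddCommGroup E] [NormedSpace ℝ E]

/-- The map `φ` agrees with an affine map in a neighbourhood of `x`. -/
def LocallyAffineAt (φ : E → E) (x : E) : Prop :=
  ∃ A : E →ᵃ[ℝ] E, φ =ᶠ[𝓝 x] A

theorem locallyAffineAt_id (x : E) : LocallyAffineAt (id : E → E) x :=
  ⟨AffineMap.id ℝ E, Eventually.of_forall fun _ => rfl⟩

variable [FiniteDimensional ℝ E]

theorem AffineMap.hasFDerivAt_of_finiteDimensional (A : E →ᵃ[ℝ] E) (x : E) :
    HasFDerivAt A (LinearMap.toContinuousLinearMap A.linear) x := by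
  have h : (A : E → E) = fun v => LinearMap.toContinuousLinearMap A.linear v + A 0 := by
    rw [AffineMap.decomp A]
    ext v
    simp
  rw [h]
  exact (ContinuousLinearMap.hasFDerivAt _).add_const _

theorem AffineMap.contDiff_of_finiteDimensional (A : E →ᵃ[ℝ] E) : ContDiff ℝ ∞ A := by
  have h : (A : E → E) = fun v => LinearMap.toContinuousLinearMap A.linear v + A 0 := by
    rw [AffineMap.decomp A]
    ext v
    simp
  rw [h]
  exact (ContinuousLinearMap.contDiff _).add contDiff_const

namespace LocallyAffineAt

variable {φ ψ : E → E} {x : E}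

theorem contDiffAt (h : LocallyAffineAt φ x) : ContDiffAt ℝ ∞ φ x := by
  obtain ⟨A, hA⟩ := h
  exact A.contDiff_of_finiteDimensional.contDiffAt.congr_of_eventuallyEq hA

theorem differentiableAt (h : LocallyAffineAt φ x) : DifferentiableAt ℝ φ x :=
  h.contDiffAt.differentiableAt (by simp)

theorem continuousAt (h : LocallyAffineAt φ x) : ContinuousAt φ x :=
  h.differentiableAt.continuousAt

theorem eventually_fderiv_eq (h : LocallyAffineAt φ x) :
    ∀ᶠ v in 𝓝 x, fderiv ℝ φ v = fderiv ℝ φ x := by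
  obtain ⟨A, hA⟩ := h
  filter_upwards [eventually_eventually_nhds.2 hA] with v hv
  rw [hA.fderiv_eq, EventuallyEq.fderiv_eq hv, (A.hasFDerivAt_of_finiteDimensional v).fderiv,
    (A.hasFDerivAt_of_finiteDimensional x).fderiv]

theorem comp (hψ : LocallyAffineAt ψ (φ x)) (hφ : LocallyAffineAt φ x) :
    LocallyAffineAt (ψ ∘ φ) x := by
  have hc := hφ.continuousAt
  obtain ⟨A, hA⟩ := hφ
  obtain ⟨B, hB⟩ := hψ
  refine ⟨B.comp A, ?_⟩
  filter_upwards [hA, hc.eventually hB] with v h1 h2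
  change ψ (φ v) = B (A v)
  rw [h2, h1]

/-- A germ of an affine map is determined by its germs at points arbitrarily close by. This is
the reason why a groupoid of germs of affine maps is Hausdorff. -/
theorem eventuallyEq_of_frequently (hφ : LocallyAffineAt φ x) (hψ : LocallyAffineAt ψ x)
    (h : ∃ᶠ v in 𝓝 x, φ =ᶠ[𝓝 v] ψ) : φ =ᶠ[𝓝 x] ψ := by
  obtain ⟨A, hA⟩ := hφ
  obtain ⟨B, hB⟩ := hψ
  obtain ⟨v, hv, hAv, hBv⟩ := (h.and_eventually
    ((eventually_eventually_nhds.2 hA).and (eventually_eventually_nhds.2 hB))).exists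
  have hAB : (A : E → E) =ᶠ[𝓝 v] B :=
    (EventuallyEq.symm hAv).trans (hv.trans hBv)
  have hlin : A.linear = B.linear := by
    have := hAB.fderiv_eq (𝕜 := ℝ)
    rw [(A.hasFDerivAt_of_finiteDimensional v).fderiv,
      (B.hasFDerivAt_of_finiteDimensional v).fderiv] at this
    exact (LinearMap.toContinuousLinearMap (𝕜 := ℝ) (E := E) (F' := E)).injective this
  have : A = B := by
    refine AffineMap.ext fun w => ?_
    have h1 := A.map_vadd v (w - v)
    have h2 := B.map_vadd v (w - v)
    rw [hlin, hAB.eq_of_nhds, ← h2] at h1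
    simpa using h1
  rw [this] at hA
  exact hA.trans hB.symm

end LocallyAffineAt

end LocallyAffine

namespace Foliation.Transversal

variable {p q : ℕ} {M : Type*} [TopologicalSpace M] [ChartedSpace (FolModel p q) M]
  {F : Foliation p q M} {T : F.Transversal}

/-! ### The holonomy groupoid as an étale groupoid -/

theorem IsAffine.locallyAffineAt (hT : T.IsAffine)
    {h : OpenPartialHomeomorph (Eucl q) (Eucl q)} (hh : T.IsHolonomyMap h) {v : Eucl q}
    (hv : v ∈ h.source) : LocallyAffineAt h v :=
  hT h hh v hv

namespace Arrow

/-- The arrow `γ` lies in the coordinate neighbourhood `{germs of h} ≅ h.source` of `G_T`. -/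
def IsGermOf (γ : T.Arrow) (h : OpenPartialHomeomorph (Eucl q) (Eucl q)) : Prop :=
  γ.src ∈ h.source ∧ γ.germ = ((h : Eucl q → Eucl q) : Germ (𝓝 γ.src) (Eucl q))

theorem tgt_eq_rep (γ : T.Arrow) : γ.tgt = γ.rep γ.src := by
  rw [tgt, γ.germ_eq_rep]
  rfl

theorem isGermOf_arrowOf {h : OpenPartialHomeomorph (Eucl q) (Eucl q)}
    (hh : T.IsHolonomyMap h) {v : Eucl q} (hv : v ∈ h.source) : (arrowOf hh hv).IsGermOf h :=
  ⟨hv, rfl⟩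

theorem isGermOf_iff {γ : T.Arrow} {h : OpenPartialHomeomorph (Eucl q) (Eucl q)} :
    γ.IsGermOf h ↔ γ.src ∈ h.source ∧ γ.rep =ᶠ[𝓝 γ.src] h := by
  rw [IsGermOf, γ.germ_eq_rep, Germ.coe_eq]

theorem IsGermOf.eq {γ γ' : T.Arrow} {h : OpenPartialHomeomorph (Eucl q) (Eucl q)}
    (hγ : γ.IsGermOf h) (hγ' : γ'.IsGermOf h) (hs : γ.src = γ'.src) : γ = γ' := by
  obtain ⟨s, g, hg⟩ := γ
  obtain ⟨s', g', hg'⟩ := γ'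
  obtain rfl : s = s' := hs
  obtain rfl : g = g' := hγ.2.trans hγ'.2.symm
  rfl

theorem IsGermOf.delta_eq {γ : T.Arrow} {h : OpenPartialHomeomorph (Eucl q) (Eucl q)}
    (hγ : γ.IsGermOf h) : γ.delta = |LinearMap.det (fderiv ℝ h γ.src).toLinearMap| := by
  rw [delta, (isGermOf_iff.1 hγ).2.fderiv_eq]

theorem near_of_mem {γ : T.Arrow} {f : T.Arrow → ℂ} {v : Eucl q} (hv : v ∈ γ.rep.source) :
    γ.near f v = f (arrowOf γ.rep_isHolonomyMap hv) := by
  rw [near, dif_pos hv]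

theorem eventually_mem_rep (γ : T.Arrow) : ∀ᶠ v in 𝓝 γ.src, v ∈ γ.rep.source :=
  γ.rep.open_source.mem_nhds γ.src_mem_rep

theorem near_add (γ : T.Arrow) (f g : T.Arrow → ℂ) : γ.near (f + g) = γ.near f + γ.near g := by
  ext v
  by_cases hv : v ∈ γ.rep.source <;> simp [near, hv]

theorem near_smul (γ : T.Arrow) (c : ℂ) (f : T.Arrow → ℂ) : γ.near (c • f) = c • γ.near f := by
  ext v
  by_cases hv : v ∈ γ.rep.source <;> simp [near, hv]

theorem near_zero (γ : T.Arrow) : γ.near 0 = 0 := by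
  ext v
  by_cases hv : v ∈ γ.rep.source <;> simp [near, hv]

end Arrow

section Bump

variable {h : OpenPartialHomeomorph (Eucl q) (Eucl q)} {g : Eucl q → ℂ} {γ : T.Arrow}

theorem bump_of_isGermOf (hγ : γ.IsGermOf h) : T.bump h g γ = g γ.src := if_pos hγ

theorem bump_of_not_isGermOf (hγ : ¬ γ.IsGermOf h) : T.bump h g γ = 0 := if_neg hγ

theorem near_bump_eventuallyEq (hγ : γ.IsGermOf h) : γ.near (T.bump h g) =ᶠ[𝓝 γ.src] g := by
  obtain ⟨hs, he⟩ := Arrow.isGermOf_iff.1 hγ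
  filter_upwards [γ.eventually_mem_rep, h.open_source.mem_nhds hs,
    eventually_eventually_nhds.2 he] with v hv hv' he'
  rw [Arrow.near_of_mem hv]
  exact bump_of_isGermOf ⟨hv', Germ.coe_eq.2 he'⟩

/-- Because `G_T` is Hausdorff, a function supported in a compact subset of a coordinate
neighbourhood vanishes near every point outside that compact set. -/
theorem near_bump_eventuallyEq_zero (hT : T.IsAffine) (hh : T.IsHolonomyMap h)
    (hg : tsupport g ⊆ h.source) (hγ : ¬ (γ.IsGermOf h ∧ γ.src ∈ tsupport g)) :
    γ.near (T.bump h g) =ᶠ[𝓝 γ.src] 0 := by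
  by_cases hs : γ.src ∈ tsupport g
  · have hne : ¬ γ.rep =ᶠ[𝓝 γ.src] h := fun he =>
      hγ ⟨Arrow.isGermOf_iff.2 ⟨hg hs, he⟩, hs⟩
    have hev : ∀ᶠ v in 𝓝 γ.src, ¬ γ.rep =ᶠ[𝓝 v] h := by
      by_contra hcon
      exact hne ((hT.locallyAffineAt γ.rep_isHolonomyMap γ.src_mem_rep).eventuallyEq_of_frequently
        (hT.locallyAffineAt hh (hg hs)) hcon)
    filter_upwards [γ.eventually_mem_rep, hev] with v hv hv'
    rw [Arrow.near_of_mem hv]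
    exact bump_of_not_isGermOf fun hc => hv' (Germ.coe_eq.1 hc.2)
  · filter_upwards [γ.eventually_mem_rep, notMem_tsupport_iff_eventuallyEq.1 hs] with v hv hv'
    rw [Arrow.near_of_mem hv]
    by_cases hc : (arrowOf γ.rep_isHolonomyMap hv).IsGermOf h
    · rw [bump_of_isGermOf hc]
      exact hv'
    · exact bump_of_not_isGermOf hc

end Bump

theorem differentiableAt_near (hT : T.IsAffine) {f : T.Arrow → ℂ} (hf : f ∈ T.smoothAlg)
    (γ : T.Arrow) : DifferentiableAt ℝ (γ.near f) γ.src := by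
  induction hf using Submodule.span_induction with
  | mem f hf =>
    obtain ⟨h, g, hh, hg, -, hsupp, rfl⟩ := hf
    by_cases hγ : γ.IsGermOf h ∧ γ.src ∈ tsupport g
    · exact (hg.differentiable (by simp)).differentiableAt.congr_of_eventuallyEq
        (near_bump_eventuallyEq hγ.1)
    · exact (differentiableAt_const (0 : ℂ)).congr_of_eventuallyEq
        (near_bump_eventuallyEq_zero hT hh hsupp hγ)
  | zero => rw [Arrow.near_zero]; exact differentiableAt_const (0 : ℂ)
  | add f g _ _ hf hg => rw [Arrow.near_add]; exact hf.add hg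
  | smul c f _ hf => rw [Arrow.near_smul]; exact hf.const_smul c

/-! ### The modular group -/

theorem near_modular_eventuallyEq (hT : T.IsAffine) (t : ℝ) (f : T.Arrow → ℂ) (γ : T.Arrow) :
    γ.near (T.modular t f) =ᶠ[𝓝 γ.src]
      fun v => (γ.delta : ℂ) ^ (Complex.I * t) * γ.near f v := by
  filter_upwards [γ.eventually_mem_rep,
    (hT.locallyAffineAt γ.rep_isHolonomyMap γ.src_mem_rep).eventually_fderiv_eq] with v hv hd
  have : (arrowOf γ.rep_isHolonomyMap hv).delta = γ.delta := by
    rw [(Arrow.isGermOf_arrowOf γ.rep_isHolonomyMap hv).delta_eq, Arrow.delta, ← hd]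
    rfl
  rw [Arrow.near_of_mem hv, Arrow.near_of_mem hv, modular, this]

theorem modular_bump (t : ℝ) (h : OpenPartialHomeomorph (Eucl q) (Eucl q)) (g : Eucl q → ℂ) :
    T.modular t (T.bump h g) = T.bump h fun v =>
      ((|LinearMap.det (fderiv ℝ h v).toLinearMap| : ℝ) : ℂ) ^ (Complex.I * t) * g v := by
  ext γ
  by_cases hγ : γ.IsGermOf h
  · rw [modular, bump_of_isGermOf hγ, bump_of_isGermOf hγ, hγ.delta_eq]
  · rw [modular, bump_of_not_isGermOf hγ, bump_of_not_isGermOf hγ, mul_zero]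

theorem modular_mem_smoothAlg (hT : T.IsAffine) (t : ℝ) {f : T.Arrow → ℂ}
    (hf : f ∈ T.smoothAlg) : T.modular t f ∈ T.smoothAlg := by
  induction hf using Submodule.span_induction with
  | mem f hf =>
    obtain ⟨h, g, hh, hg, hc, hsupp, rfl⟩ := hf
    rw [modular_bump]
    refine Submodule.subset_span ⟨h, _, hh, ?_, hc.mul_left,
      (tsupport_mul_subset_right).trans hsupp, rfl⟩
    refine contDiff_iff_contDiffAt.2 fun x => ?_
    by_cases hx : x ∈ tsupport g
    · refine (contDiffAt_const.mul hg.contDiffAt).congr_of_eventuallyEq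
        (f₁ := fun v => ((|LinearMap.det (fderiv ℝ h v).toLinearMap| : ℝ) : ℂ) ^
          (Complex.I * t) * g v)
        (f := fun v => ((|LinearMap.det (fderiv ℝ h x).toLinearMap| : ℝ) : ℂ) ^
          (Complex.I * t) * g v) ?_
      filter_upwards [(hT.locallyAffineAt hh (hsupp hx)).eventually_fderiv_eq] with v hv
      rw [hv]
    · refine (contDiffAt_const (c := (0 : ℂ))).congr_of_eventuallyEq ?_
      filter_upwards [notMem_tsupport_iff_eventuallyEq.1 hx] with v hv
      rw [Pi.mul_apply, hv, Pi.zero_apply, mul_zero]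
  | zero =>
    convert T.smoothAlg.zero_mem
    ext γ
    simp [modular]
  | add f g _ _ hf hg =>
    convert T.smoothAlg.add_mem hf hg
    ext γ
    simp [modular, mul_add]
  | smul c f _ hf =>
    convert T.smoothAlg.smul_mem c hf
    ext γ
    simp only [modular, Pi.smul_apply, smul_eq_mul]
    ring

/-! ### Composable strings of arrows -/

namespace Arrow

/-- The string `γ₁, …, γ_k` of arrows is composable and starts at `x`, in the sense that
`s γ_i = (γ_{i+1} ⋯ γ_k)(x)` for all `i`. -/
def Composable (x : Eucl q) : List T.Arrow → Prop
  | [] => True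
  | γ :: l => γ.src = prodRep l x ∧ Composable x l

variable {x : Eucl q}

theorem composable_ofFn {n : ℕ} {γ : Fin (n + 1) → T.Arrow} (hlast : (γ (Fin.last n)).src = x)
    (hγ : ∀ j : Fin n, (γ j.castSucc).src = (γ j.succ).tgt) : Composable x (List.ofFn γ) := by
  induction n with
  | zero => simpa [List.ofFn_succ, Composable, prodRep] using hlast
  | succ n ih =>
    have h := ih (γ := fun j => γ j.succ) (by simpa using hlast) fun j => by
      simpa using hγ j.succ
    rw [List.ofFn_succ]
    refine ⟨?_, h⟩
    rw [List.ofFn_succ] at h ⊢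
    have h0 := hγ 0
    rw [tgt_eq_rep] at h0
    change _ = (γ (Fin.succ 0)).rep (prodRep _ x)
    rw [← h.1]
    exact h0

theorem Composable.drop {l : List T.Arrow} (hl : Composable x l) (n : ℕ) :
    Composable x (l.drop n) := by
  induction n generalizing l with
  | zero => simpa
  | succ n ih =>
    cases l with
    | nil => simpa
    | cons γ l => exact ih hl.2

theorem Composable.src_getElem {l : List T.Arrow} (hl : Composable x l) {n : ℕ}
    (hn : n < l.length) : l[n].src = prodRep (l.drop (n + 1)) x := by
  have := hl.drop n
  rw [List.drop_eq_getElem_cons hn] at this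
  exact this.1

theorem Composable.src_ofFn {n : ℕ} {γ : Fin n → T.Arrow} (hl : Composable x (List.ofFn γ))
    (j : Fin n) : (γ j).src = prodRep ((List.ofFn γ).drop ((j : ℕ) + 1)) x := by
  have := hl.src_getElem (n := j) (by simp)
  simpa using this

theorem Composable.locallyAffineAt (hT : T.IsAffine) {l : List T.Arrow} (hl : Composable x l) :
    LocallyAffineAt (prodRep l) x := by
  induction l with
  | nil => exact locallyAffineAt_id x
  | cons γ l ih =>
    refine LocallyAffineAt.comp (ψ := γ.rep) (φ := prodRep l) ?_ (ih hl.2)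
    rw [← hl.1]
    exact hT.locallyAffineAt γ.rep_isHolonomyMap γ.src_mem_rep

/-- The Jacobian `δ` is multiplicative along composable strings. -/
theorem Composable.prod_delta (hT : T.IsAffine) {l : List T.Arrow} (hl : Composable x l) :
    (l.map delta).prod = |LinearMap.det (fderiv ℝ (prodRep l) x).toLinearMap| := by
  induction l with
  | nil => simp [prodRep]
  | cons γ l ih =>
    have hγ := hT.locallyAffineAt γ.rep_isHolonomyMap γ.src_mem_rep
    have h1 : fderiv ℝ (prodRep (γ :: l)) x =
        (fderiv ℝ γ.rep γ.src).comp (fderiv ℝ (prodRep l) x) := by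
      rw [hl.1] at hγ ⊢
      exact fderiv_comp x hγ.differentiableAt (hl.2.locallyAffineAt hT).differentiableAt
    rw [List.map_cons, List.prod_cons, ih hl.2, h1, delta, ← abs_mul,
      ContinuousLinearMap.toLinearMap_comp, LinearMap.det_comp]

end Arrow

theorem IsLoop.composable {x : Eucl q} {γ : Fin (q + 1) → T.Arrow} (hγ : T.IsLoop x γ) :
    Arrow.Composable x (List.ofFn γ) :=
  Arrow.composable_ofFn hγ.1 hγ.2.1

theorem IsLoop.prod_delta (hT : T.IsAffine) {x : Eucl q} {γ : Fin (q + 1) → T.Arrow}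
    (hγ : T.IsLoop x γ) : ∏ j, (γ j).delta = 1 := by
  have h := hγ.composable.prod_delta hT
  rw [hγ.2.2.fderiv_eq, List.map_ofFn, List.prod_ofFn] at h
  simpa using h

/-! ### Invariance of the fundamental cocycle -/

theorem dLoop_congr {x : Eucl q} {f f' : Fin (q + 1) → T.Arrow → ℂ} {γ : Fin (q + 1) → T.Arrow}
    {j : Fin (q + 1)} (h : f j = f' j) : T.dLoop x f γ j = T.dLoop x f' γ j := by
  rw [dLoop, dLoop, h]

section DLoop

variable {x : Eucl q} {γ : Fin (q + 1) → T.Arrow}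

theorem IsLoop.tendsto (hT : T.IsAffine) (hγ : T.IsLoop x γ) (j : Fin (q + 1)) :
    Tendsto (Arrow.prodRep ((List.ofFn γ).drop ((j : ℕ) + 1))) (𝓝 x) (𝓝 (γ j).src) := by
  rw [hγ.composable.src_ofFn j]
  exact ((hγ.composable.drop _).locallyAffineAt hT).continuousAt

theorem IsLoop.differentiableAt (hT : T.IsAffine) (hγ : T.IsLoop x γ) (j : Fin (q + 1))
    {f : T.Arrow → ℂ} (hf : f ∈ T.smoothAlg) :
    DifferentiableAt ℝ
      (fun v => (γ j).near f (Arrow.prodRep ((List.ofFn γ).drop ((j : ℕ) + 1)) v)) x := by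
  have h := differentiableAt_near hT hf (γ j)
  rw [hγ.composable.src_ofFn j] at h
  exact h.comp x ((hγ.composable.drop _).locallyAffineAt hT).differentiableAt

theorem IsLoop.dLoop_modular (hT : T.IsAffine) (hγ : T.IsLoop x γ)
    {f : Fin (q + 1) → T.Arrow → ℂ} (hf : ∀ j, f j ∈ T.smoothAlg) (t : ℝ) (j : Fin (q + 1)) :
    T.dLoop x (fun j => T.modular t (f j)) γ j =
      ((γ j).delta : ℂ) ^ (Complex.I * t) • T.dLoop x f γ j := by
  rw [dLoop, dLoop, ← fderiv_const_smul (hγ.differentiableAt hT j (hf j))]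
  exact EventuallyEq.fderiv_eq
    ((hγ.tendsto hT j).eventually (near_modular_eventuallyEq hT t (f j) (γ j)))

theorem IsLoop.loopTerm_modular (hT : T.IsAffine) (hγ : T.IsLoop x γ)
    {f : Fin (q + 1) → T.Arrow → ℂ} (hf : ∀ j, f j ∈ T.smoothAlg) (t : ℝ) :
    T.loopTerm x (fun j => T.modular t (f j)) γ = T.loopTerm x f γ := by
  have hprod : ∏ j, ((γ j).delta : ℂ) ^ (Complex.I * t) = 1 := by
    have hnonneg : ∀ j, 0 ≤ (γ j).delta := fun j => abs_nonneg _
    have key : ∀ s : Finset (Fin (q + 1)), ∏ j ∈ s, ((γ j).delta : ℂ) ^ (Complex.I * t) =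
        ((∏ j ∈ s, (γ j).delta : ℝ) : ℂ) ^ (Complex.I * t) := by
      intro s
      induction s using Finset.induction_on with
      | empty => simp
      | insert a s ha ih =>
        rw [Finset.prod_insert ha, Finset.prod_insert ha, ih, Complex.ofReal_mul,
          Complex.mul_cpow_ofReal_nonneg (hnonneg a) (Finset.prod_nonneg fun j _ => hnonneg j)]
    rw [key, hγ.prod_delta hT, Complex.ofReal_one, Complex.one_cpow]
  rw [Fin.prod_univ_succ] at hprod
  simp only [loopTerm, hγ.dLoop_modular hT hf, _root_.smul_apply, smul_eq_mul]
  have hdet := Matrix.det_mul_column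
    (fun j : Fin q => ((γ j.succ).delta : ℂ) ^ (Complex.I * t))
    (Matrix.of fun j i : Fin q => T.dLoop x f γ j.succ (EuclideanSpace.single i (1 : ℝ)))
  simp only [Matrix.of_apply] at hdet
  rw [hdet, modular]
  linear_combination (f 0 (γ 0) * (Matrix.of fun j i : Fin q =>
    T.dLoop x f γ j.succ (EuclideanSpace.single i (1 : ℝ))).det) * hprod

end DLoop

theorem fundCocycle_modular (hT : T.IsAffine) {f : Fin (q + 1) → T.Arrow → ℂ}
    (hf : ∀ j, f j ∈ T.smoothAlg) (t : ℝ) :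
    T.fundCocycle (fun j => T.modular t (f j)) = T.fundCocycle f := by
  have : T.loopSum (fun j => T.modular t (f j)) = T.loopSum f := by
    ext x
    exact finsum_congr fun γ => γ.2.loopTerm_modular hT hf t
  rw [fundCocycle, fundCocycle, this]

end Foliation.Transversal

namespace Foliation.Transversal

variable {p q : ℕ} {M : Type*} [TopologicalSpace M] [ChartedSpace (FolModel p q) M]
  {F : Foliation p q M} {T : F.Transversal}

/-! ### Composites of holonomy maps -/

section Composite

variable {E : Type*} [NormedAddCommGroup E]

/-- The composite `h₁ ∘ h₂ ∘ ⋯ ∘ h_k` of a list of partial homeomorphisms, on its maximal domain. -/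
def composite : List (OpenPartialHomeomorph E E) → OpenPartialHomeomorph E E
  | [] => OpenPartialHomeomorph.refl E
  | h :: l => (composite l).trans h

theorem mem_composite_cons {h : OpenPartialHomeomorph E E} {l : List (OpenPartialHomeomorph E E)}
    {x : E} : x ∈ (composite (h :: l)).source ↔
      x ∈ (composite l).source ∧ composite l x ∈ h.source := by
  simp [composite]

theorem composite_drop_source {l : List (OpenPartialHomeomorph E E)} (n : ℕ) :
    (composite l).source ⊆ (composite (l.drop n)).source := by
  induction n generalizing l with
  | zero => simp
  | succ n ih =>
    cases l with
    | nil => simp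
    | cons h l => exact fun x hx => ih (mem_composite_cons.1 hx).1

theorem composite_mem_source_getElem {l : List (OpenPartialHomeomorph E E)} {x : E}
    (hx : x ∈ (composite l).source) {n : ℕ} (hn : n < l.length) :
    composite (l.drop (n + 1)) x ∈ l[n].source := by
  have := composite_drop_source n hx
  rw [List.drop_eq_getElem_cons hn] at this
  exact (mem_composite_cons.1 this).2

/-- The domain on which the successive images under a string of partial homeomorphisms
stay in prescribed closed subsets of the successive sources is compact. -/
theorem isCompact_inter_setOf_composite_mem {C : Set E} (hC : IsCompact C)
    (l : List (OpenPartialHomeomorph E E)) (K : ℕ → Set E) (hK : ∀ i, IsClosed (K i))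
    (hKs : ∀ i (hi : i < l.length), K i ⊆ l[i].source) :
    IsCompact {x | x ∈ C ∧ ∀ i < l.length, composite (l.drop (i + 1)) x ∈ K i} ∧
      {x | x ∈ C ∧ ∀ i < l.length, composite (l.drop (i + 1)) x ∈ K i} ⊆ (composite l).source := by
  induction l generalizing K with
  | nil => simpa [composite] using hC
  | cons h l ih =>
    obtain ⟨hc, hs⟩ := ih (fun i => K (i + 1)) (fun i => hK _)
      fun i hi => hKs (i + 1) (by simpa using hi)
    have heq : {x | x ∈ C ∧ ∀ i < (h :: l).length, composite ((h :: l).drop (i + 1)) x ∈ K i} =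
        {x | x ∈ C ∧ ∀ i < l.length, composite (l.drop (i + 1)) x ∈ K (i + 1)} ∩
          composite l ⁻¹' K 0 := by
      ext x
      simp only [List.length_cons, Nat.forall_lt_succ_left, mem_ofPred_eq, mem_inter_iff,
        mem_preimage, List.drop_succ_cons, List.drop_zero]
      tauto
    rw [heq]
    refine ⟨?_, fun x hx => mem_composite_cons.2 ⟨hs hx.1, hKs 0 (by simp) hx.2⟩⟩
    exact hc.of_isClosed_subset
      (((composite l).continuousOn.mono hs).preimage_isClosed_of_isClosed hc.isClosed (hK 0))
      inter_subset_left

end Composite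

theorem locallyAffineAt_composite (hT : T.IsAffine)
    {l : List (OpenPartialHomeomorph (Eucl q) (Eucl q))} (hl : ∀ h ∈ l, T.IsHolonomyMap h)
    {x : Eucl q} (hx : x ∈ (composite l).source) : LocallyAffineAt (composite l) x := by
  induction l with
  | nil => exact locallyAffineAt_id x
  | cons h l ih =>
    have hx' := mem_composite_cons.1 hx
    exact LocallyAffineAt.comp (ψ := h) (φ := composite l)
      (hT.locallyAffineAt (hl h (by simp)) hx'.2)
      (ih (fun h' hh' => hl h' (by simp [hh'])) hx'.1)

theorem Arrow.Composable.prodRep_eventuallyEq {l : List T.Arrow}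
    {m : List (OpenPartialHomeomorph (Eucl q) (Eucl q))} {x : Eucl q} (hl : Arrow.Composable x l)
    (hlm : List.Forall₂ Arrow.IsGermOf l m) :
    x ∈ (composite m).source ∧ Arrow.prodRep l =ᶠ[𝓝 x] composite m := by
  induction hlm with
  | nil => exact ⟨mem_univ _, Eventually.of_forall fun _ => rfl⟩
  | @cons γ h l m hγ _ ih =>
    obtain ⟨hx, he⟩ := ih hl.2
    have hsrc : γ.src = composite m x := hl.1.trans he.eq_of_nhds
    obtain ⟨hs, hr⟩ := Arrow.isGermOf_iff.1 hγ
    rw [hsrc] at hs hr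
    refine ⟨mem_composite_cons.2 ⟨hx, hs⟩, ?_⟩
    filter_upwards [he, ((composite m).continuousAt hx).eventually hr] with v h1 h2
    change γ.rep (Arrow.prodRep l v) = h (composite m v)
    rw [h1, h2]

/-! ### The density of a string of bump functions -/

section BumpDensity

variable {h : Fin (q + 1) → OpenPartialHomeomorph (Eucl q) (Eucl q)}
  {g : Fin (q + 1) → Eucl q → ℂ} {x : Eucl q} {γ : Fin (q + 1) → T.Arrow}

/-- The composite `h_{j+1} ∘ ⋯ ∘ h_q`. -/
noncomputable def tailComposite (h : Fin (q + 1) → OpenPartialHomeomorph (Eucl q) (Eucl q))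
    (j : Fin (q + 1)) : OpenPartialHomeomorph (Eucl q) (Eucl q) :=
  composite ((List.ofFn h).drop ((j : ℕ) + 1))

theorem tailComposite_source (j : Fin (q + 1)) :
    (composite (List.ofFn h)).source ⊆ (tailComposite h j).source :=
  composite_drop_source _

theorem tailComposite_mem_source (hx : x ∈ (composite (List.ofFn h)).source) (j : Fin (q + 1)) :
    tailComposite h j x ∈ (h j).source := by
  have := composite_mem_source_getElem hx (n := j) (by rw [List.length_ofFn]; exact j.isLt)
  rwa [List.getElem_ofFn] at this

theorem tailComposite_last : tailComposite h (Fin.last q) = OpenPartialHomeomorph.refl _ := by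
  have : (List.ofFn h).drop ((Fin.last q : ℕ) + 1) = [] := by simp
  rw [tailComposite, this, composite]

theorem tailComposite_castSucc (j : Fin q) :
    tailComposite h j.castSucc = (tailComposite h j.succ).trans (h j.succ) := by
  rw [tailComposite, tailComposite,
    List.drop_eq_getElem_cons (by simp)]
  simp only [composite, List.getElem_ofFn]
  rfl

/-- The coefficient of `g⁰(h₁ ⋯ h_q) d(g¹(h₂ ⋯ h_q)) ∧ ⋯ ∧ d(g^q)`, which is the contribution to
the fundamental cocycle of the loops formed by germs of `h₀, …, h_q`. -/
noncomputable def bumpDensity (h : Fin (q + 1) → OpenPartialHomeomorph (Eucl q) (Eucl q))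
    (g : Fin (q + 1) → Eucl q → ℂ) (x : Eucl q) : ℂ :=
  g 0 (tailComposite h 0 x) *
    (Matrix.of fun j i : Fin q => fderiv ℝ (fun v => g j.succ (tailComposite h j.succ v)) x
      (EuclideanSpace.single i (1 : ℝ))).det

theorem forall₂_isGermOf (hγh : ∀ j, (γ j).IsGermOf (h j)) :
    List.Forall₂ Arrow.IsGermOf (List.ofFn γ) (List.ofFn h) := by
  rw [List.forall₂_iff_get]
  exact ⟨by simp, fun i h1 h2 => by simpa [-List.ofFn_succ] using hγh _⟩

theorem Arrow.Composable.prodRep_drop_eventuallyEq (hγ : Arrow.Composable x (List.ofFn γ))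
    (hγh : ∀ j, (γ j).IsGermOf (h j)) (j : Fin (q + 1)) :
    Arrow.prodRep ((List.ofFn γ).drop ((j : ℕ) + 1)) =ᶠ[𝓝 x] tailComposite h j :=
  ((hγ.drop _).prodRep_eventuallyEq (List.forall₂_drop _ (forall₂_isGermOf hγh))).2

theorem Arrow.Composable.src_eq (hγ : Arrow.Composable x (List.ofFn γ))
    (hγh : ∀ j, (γ j).IsGermOf (h j)) (j : Fin (q + 1)) : (γ j).src = tailComposite h j x := by
  rw [hγ.src_ofFn j, (hγ.prodRep_drop_eventuallyEq hγh j).eq_of_nhds]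

theorem IsLoop.loopTerm_bump (hT : T.IsAffine) (hγ : T.IsLoop x γ)
    (hγh : ∀ j, (γ j).IsGermOf (h j)) :
    T.loopTerm x (fun j => T.bump (h j) (g j)) γ = bumpDensity h g x := by
  have hd : ∀ j, T.dLoop x (fun j => T.bump (h j) (g j)) γ j =
      fderiv ℝ (fun v => g j (tailComposite h j v)) x := by
    intro j
    refine EventuallyEq.fderiv_eq ?_
    filter_upwards [(hγ.tendsto hT j).eventually (near_bump_eventuallyEq (g := g j) (hγh j)),
      hγ.composable.prodRep_drop_eventuallyEq hγh j] with v h1 h2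
    rw [h1, h2]
  simp only [loopTerm, bumpDensity, hd]
  rw [bump_of_isGermOf (hγh 0), hγ.composable.src_eq hγh 0]

theorem isGermOf_of_loopTerm_ne_zero (hT : T.IsAffine) (hh : ∀ j, T.IsHolonomyMap (h j))
    (hg : ∀ j, tsupport (g j) ⊆ (h j).source) (hγ : T.IsLoop x γ)
    (hne : T.loopTerm x (fun j => T.bump (h j) (g j)) γ ≠ 0) (j : Fin (q + 1)) :
    (γ j).IsGermOf (h j) ∧ (γ j).src ∈ tsupport (g j) := by
  by_contra hcon
  refine hne ?_
  rw [loopTerm]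
  induction j using Fin.cases with
  | zero =>
    have h0 : T.bump (h 0) (g 0) (γ 0) = 0 := by
      by_cases h1 : (γ 0).IsGermOf (h 0)
      · rw [bump_of_isGermOf h1]
        exact image_eq_zero_of_notMem_tsupport fun h2 => hcon ⟨h1, h2⟩
      · exact bump_of_not_isGermOf h1
    rw [h0, zero_mul]
  | succ j =>
    have h0 : T.dLoop x (fun j => T.bump (h j) (g j)) γ j.succ = 0 := by
      have h1 := (near_bump_eventuallyEq_zero hT (hh _) (hg _) hcon).comp_tendsto
        (hγ.tendsto hT j.succ)
      exact (EventuallyEq.fderiv_eq h1).trans (fderiv_const_apply (0 : ℂ))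
    rw [Matrix.det_eq_zero_of_row_eq_zero j, mul_zero]
    intro i
    simp [h0]

/-- Where the composite of the holonomy maps `h_j` is the identity, their germs form a loop. -/
theorem exists_isLoop (hh : ∀ j, T.IsHolonomyMap (h j))
    (hx : x ∈ (composite (List.ofFn h)).source) (hid : composite (List.ofFn h) =ᶠ[𝓝 x] id) :
    ∃ γ, T.IsLoop x γ ∧ ∀ j, (γ j).IsGermOf (h j) := by
  let γ : Fin (q + 1) → T.Arrow := fun j => arrowOf (hh j) (tailComposite_mem_source hx j)
  have hγh : ∀ j, (γ j).IsGermOf (h j) := fun j => Arrow.isGermOf_arrowOf _ _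
  have hlast : (γ (Fin.last q)).src = x := by
    change tailComposite h (Fin.last q) x = x
    rw [tailComposite_last]
    rfl
  have hcomp : ∀ j : Fin q, (γ j.castSucc).src = (γ j.succ).tgt := by
    intro j
    change tailComposite h j.castSucc x = h j.succ (tailComposite h j.succ x)
    rw [tailComposite_castSucc]
    rfl
  refine ⟨γ, ⟨hlast, hcomp, ?_⟩, hγh⟩
  exact ((Arrow.composable_ofFn hlast hcomp).prodRep_eventuallyEq (forall₂_isGermOf hγh)).2.trans
    hid

theorem IsLoop.eq_of_isGermOf {γ' : Fin (q + 1) → T.Arrow} (hγ : T.IsLoop x γ)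
    (hγ' : T.IsLoop x γ') (hγh : ∀ j, (γ j).IsGermOf (h j)) (hγh' : ∀ j, (γ' j).IsGermOf (h j)) :
    γ = γ' :=
  funext fun j => (hγh j).eq (hγh' j) <| by
    rw [hγ.composable.src_eq hγh, hγ'.composable.src_eq hγh']

theorem continuousOn_bumpDensity (hT : T.IsAffine) (hh : ∀ j, T.IsHolonomyMap (h j))
    (hg : ∀ j, ContDiff ℝ ∞ (g j)) :
    ContinuousOn (bumpDensity h g) (composite (List.ofFn h)).source := by
  have hd : ∀ j, ContDiffOn ℝ ∞ (fun v => g j (tailComposite h j v))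
      (composite (List.ofFn h)).source := by
    intro j x hx
    have h1 : LocallyAffineAt (tailComposite h j) x := by
      refine locallyAffineAt_composite hT (fun h' hh' => ?_) (tailComposite_source j hx)
      obtain ⟨i, rfl⟩ := (List.mem_ofFn' _ _).1 (List.mem_of_mem_drop hh')
      exact hh i
    exact ((hg j).contDiffAt.comp x h1.contDiffAt).contDiffWithinAt
  refine (hd 0).continuousOn.mul (continuous_id.matrix_det.comp_continuousOn
    (continuousOn_pi.2 fun j => continuousOn_pi.2 fun i => ?_))
  exact ((hd j.succ).continuousOn_fderiv_of_isOpen (composite _).open_source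
    (by simp)).clm_apply continuousOn_const

theorem fundCocycleDefined_bump (hT : T.IsAffine) (hh : ∀ j, T.IsHolonomyMap (h j))
    (hg : ∀ j, ContDiff ℝ ∞ (g j)) (hc : ∀ j, HasCompactSupport (g j))
    (hs : ∀ j, tsupport (g j) ⊆ (h j).source) :
    T.FundCocycleDefined (fun j => T.bump (h j) (g j)) := by
  have hgerm := fun x γ (hγ : T.IsLoop x γ) hne j =>
    isGermOf_of_loopTerm_ne_zero (x := x) (γ := γ) hT hh hs hγ hne j
  refine ⟨fun x _ => Set.Subsingleton.finite fun γ hγ γ' hγ' => ?_, ?_⟩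
  · exact hγ.1.eq_of_isGermOf hγ'.1 (fun j => (hgerm _ _ hγ.1 hγ.2 j).1)
      fun j => (hgerm _ _ hγ'.1 hγ'.2 j).1
  -- The density is the smooth function `bumpDensity h g` on `U ∩ K`, where `U` is the open set of
  -- base points of loops and `K` is the compact set of points whose successive images lie in the
  -- supports of the functions `g j`; it vanishes elsewhere.
  let U : Set (Eucl q) := {x | composite (List.ofFn h) =ᶠ[𝓝 x] id}
  let K : Set (Eucl q) := {x | x ∈ tsupport (g (Fin.last q)) ∧ ∀ i < (List.ofFn h).length,
    composite ((List.ofFn h).drop (i + 1)) x ∈ if hi : i < q + 1 then tsupport (g ⟨i, hi⟩) else ∅}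
  have hU : IsOpen U := isOpen_setOfPred_eventually_nhds
  obtain ⟨hK, hKs⟩ : IsCompact K ∧ K ⊆ (composite (List.ofFn h)).source := by
    refine isCompact_inter_setOf_composite_mem (hc _) _ _ (fun i => ?_) fun i hi => ?_
    · split_ifs
      · exact isClosed_tsupport _
      · exact isClosed_empty
    · have hi' : i < q + 1 := by simpa using hi
      simpa [hi', -List.ofFn_succ] using hs ⟨i, hi'⟩
  have hsum : T.loopSum (fun j => T.bump (h j) (g j)) = (U ∩ K).indicator (bumpDensity h g) := by
    ext x
    by_cases hx : x ∈ U ∩ K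
    · obtain ⟨γ, hγ, hγh⟩ := exists_isLoop hh (hKs hx.2) hx.1
      rw [indicator_of_mem hx, ← hγ.loopTerm_bump (g := g) hT hγh, loopSum]
      refine finsum_eq_single _ (⟨γ, hγ⟩ : {γ // T.IsLoop x γ}) fun γ' hne => ?_
      by_contra hγ'
      exact hne (Subtype.ext (γ'.2.eq_of_isGermOf hγ (fun j => (hgerm _ _ γ'.2 hγ' j).1) hγh))
    · rw [indicator_of_notMem hx, loopSum]
      refine finsum_eq_zero_of_forall_eq_zero fun γ => ?_
      by_contra hne
      have hγ := hgerm _ _ γ.2 hne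
      have hcomp := γ.2.composable
      obtain ⟨-, he⟩ := hcomp.prodRep_eventuallyEq (forall₂_isGermOf fun j => (hγ j).1)
      refine hx ⟨he.symm.trans γ.2.2.2, ?_, fun i hi => ?_⟩
      · have := (hγ (Fin.last q)).2
        rwa [γ.2.1] at this
      · have hi' : i < q + 1 := by simpa using hi
        have := (hγ ⟨i, hi'⟩).2
        rw [hcomp.src_eq fun j => (hγ j).1] at this
        rwa [dif_pos hi']
  rw [hsum]
  refine Integrable.integrableOn ?_
  rw [integrable_indicator_iff (hU.measurableSet.inter hK.measurableSet)]
  exact (((continuousOn_bumpDensity hT hh hg).mono hKs).integrableOn_compact hK).mono_set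
    inter_subset_right

end BumpDensity

/-! ### Multilinearity of the density -/

section Multilinear

variable {x : Eucl q} {γ : Fin (q + 1) → T.Arrow} {f : Fin (q + 1) → T.Arrow → ℂ}

theorem loopTerm_update_zero (a : T.Arrow → ℂ) :
    T.loopTerm x (Function.update f 0 a) γ = a (γ 0) *
      (Matrix.of fun j i : Fin q =>
        T.dLoop x f γ j.succ (EuclideanSpace.single i (1 : ℝ))).det := by
  have h (j : Fin q) : T.dLoop x (Function.update f 0 a) γ j.succ = T.dLoop x f γ j.succ :=
    dLoop_congr (Function.update_of_ne (Fin.succ_ne_zero j) _ _)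
  simp only [loopTerm, Function.update_self, h]

theorem loopTerm_update_succ (a : T.Arrow → ℂ) (k : Fin q) :
    T.loopTerm x (Function.update f k.succ a) γ = f 0 (γ 0) *
      (Matrix.updateRow
        (Matrix.of fun j i : Fin q => T.dLoop x f γ j.succ (EuclideanSpace.single i (1 : ℝ))) k
        fun i => T.dLoop x (fun _ => a) γ k.succ (EuclideanSpace.single i (1 : ℝ))).det := by
  rw [loopTerm, Function.update_of_ne (Fin.succ_ne_zero k).symm]
  congr 2
  ext j i
  rcases eq_or_ne j k with rfl | hjk
  · rw [Matrix.updateRow_self, Matrix.of_apply,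
      dLoop_congr (f' := fun _ => a) (Function.update_self _ _ _)]
  · rw [Matrix.updateRow_ne hjk, Matrix.of_apply, Matrix.of_apply, dLoop_congr (f' := f)
      (Function.update_of_ne (fun h => hjk (Fin.succ_injective _ h)) _ _)]

theorem IsLoop.loopTerm_update_add (hT : T.IsAffine) (hγ : T.IsLoop x γ) (j : Fin (q + 1))
    {a b : T.Arrow → ℂ} (ha : a ∈ T.smoothAlg) (hb : b ∈ T.smoothAlg) :
    T.loopTerm x (Function.update f j (a + b)) γ =
      T.loopTerm x (Function.update f j a) γ + T.loopTerm x (Function.update f j b) γ := by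
  induction j using Fin.cases with
  | zero => simp only [loopTerm_update_zero, Pi.add_apply, add_mul]
  | succ k =>
    have h : T.dLoop x (fun _ => a + b) γ k.succ =
        T.dLoop x (fun _ => a) γ k.succ + T.dLoop x (fun _ => b) γ k.succ := by
      simp only [dLoop, Arrow.near_add]
      exact fderiv_add (hγ.differentiableAt hT k.succ ha) (hγ.differentiableAt hT k.succ hb)
    simp only [loopTerm_update_succ, ← mul_add, ← Matrix.det_updateRow_add, h]
    rfl

theorem IsLoop.loopTerm_update_smul (hT : T.IsAffine) (hγ : T.IsLoop x γ) (j : Fin (q + 1))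
    (c : ℂ) {a : T.Arrow → ℂ} (ha : a ∈ T.smoothAlg) :
    T.loopTerm x (Function.update f j (c • a)) γ =
      c * T.loopTerm x (Function.update f j a) γ := by
  induction j using Fin.cases with
  | zero => simp only [loopTerm_update_zero, Pi.smul_apply, smul_eq_mul, mul_assoc]
  | succ k =>
    have h : T.dLoop x (fun _ => c • a) γ k.succ = c • T.dLoop x (fun _ => a) γ k.succ := by
      simp only [dLoop, Arrow.near_smul]
      exact fderiv_const_smul (hγ.differentiableAt hT k.succ ha) c
    simp only [loopTerm_update_succ, h]
    rw [mul_left_comm]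
    congr 1
    rw [← Matrix.det_updateRow_smul]
    rfl

theorem FundCocycleDefined.update_add (hT : T.IsAffine) (j : Fin (q + 1)) {a b : T.Arrow → ℂ}
    (ha : a ∈ T.smoothAlg) (hb : b ∈ T.smoothAlg)
    (hfa : T.FundCocycleDefined (Function.update f j a))
    (hfb : T.FundCocycleDefined (Function.update f j b)) :
    T.FundCocycleDefined (Function.update f j (a + b)) := by
  refine ⟨fun x hx => ((hfa.1 x hx).union (hfb.1 x hx)).subset fun γ hγ => ?_, ?_⟩
  · by_contra hcon
    simp only [mem_union, mem_ofPred_eq, hγ.1, true_and, not_or, not_not] at hcon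
    exact hγ.2 (by rw [hγ.1.loopTerm_update_add hT j ha hb, hcon.1, hcon.2, add_zero])
  · refine (hfa.2.add hfb.2).congr_fun (fun x hx => ?_) T.isOpen_domain.measurableSet
    have hfin (a : T.Arrow → ℂ) (hfa : T.FundCocycleDefined (Function.update f j a)) :
        (Function.support fun γ : {γ // T.IsLoop x γ} =>
          T.loopTerm x (Function.update f j a) γ.1).Finite :=
      .of_finite_image ((hfa.1 x hx).subset (by rintro _ ⟨γ, hγ, rfl⟩; exact ⟨γ.2, hγ⟩))
        Subtype.val_injective.injOn
    simp only [loopSum, Pi.add_apply]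
    rw [← finsum_add_distrib (hfin a hfa) (hfin b hfb)]
    exact finsum_congr fun γ => (γ.2.loopTerm_update_add hT j ha hb).symm

theorem FundCocycleDefined.update_smul (hT : T.IsAffine) (j : Fin (q + 1)) (c : ℂ)
    {a : T.Arrow → ℂ} (ha : a ∈ T.smoothAlg)
    (hfa : T.FundCocycleDefined (Function.update f j a)) :
    T.FundCocycleDefined (Function.update f j (c • a)) := by
  refine ⟨fun x hx => (hfa.1 x hx).subset fun γ hγ => ⟨hγ.1, fun h0 => hγ.2 ?_⟩, ?_⟩
  · rw [hγ.1.loopTerm_update_smul hT j c ha, h0, mul_zero]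
  · refine IntegrableOn.congr_fun (hfa.2.const_mul c) (fun x hx => ?_) T.isOpen_domain.measurableSet
    simp only [loopSum]
    rw [mul_finsum]
    exact finsum_congr fun γ => (γ.2.loopTerm_update_smul hT j c ha).symm

/-- Finiteness and integrability hold for the generators of `C_c^∞(G_T)`, and are extended to the
linear span in one slot after the other. -/
theorem fundCocycleDefined (hT : T.IsAffine) (hf : ∀ j, f j ∈ T.smoothAlg) :
    T.FundCocycleDefined f := by
  have key (s : Finset (Fin (q + 1))) : ∀ f : Fin (q + 1) → T.Arrow → ℂ,
      (∀ j, f j ∈ T.smoothAlg) →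
      (∀ j ∉ s, ∃ (h : OpenPartialHomeomorph (Eucl q) (Eucl q)) (g : Eucl q → ℂ),
        T.IsHolonomyMap h ∧ ContDiff ℝ ∞ g ∧ HasCompactSupport g ∧ tsupport g ⊆ h.source ∧
        f j = T.bump h g) → T.FundCocycleDefined f := by
    induction s using Finset.induction_on with
    | empty =>
      intro f _ hb
      choose h g hh hg hc hs hfb using fun j => hb j (Finset.notMem_empty j)
      rw [funext hfb]
      exact fundCocycleDefined_bump hT hh hg hc hs
    | insert k s hk ih =>
      intro f hf hb
      have hupd (a : T.Arrow → ℂ) (ha : a ∈ T.smoothAlg) (j : Fin (q + 1)) :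
          Function.update f k a j ∈ T.smoothAlg := by
        rcases eq_or_ne j k with rfl | hjk
        · simpa using ha
        · simpa [hjk] using hf j
      suffices H : ∀ a ∈ T.smoothAlg, T.FundCocycleDefined (Function.update f k a) by
        simpa using H (f k) (hf k)
      intro a ha
      have hgen (a : T.Arrow → ℂ) (ha : ∃ (h : OpenPartialHomeomorph (Eucl q) (Eucl q))
          (g : Eucl q → ℂ), T.IsHolonomyMap h ∧ ContDiff ℝ ∞ g ∧ HasCompactSupport g ∧
          tsupport g ⊆ h.source ∧ a = T.bump h g) :
          T.FundCocycleDefined (Function.update f k a) := by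
        refine ih _ (hupd a (Submodule.subset_span ha)) fun j hj => ?_
        rcases eq_or_ne j k with rfl | hjk
        · simpa using ha
        · simpa [hjk] using hb j (by simp [hjk, hj])
      induction ha using Submodule.span_induction with
      | mem a ha => exact hgen a ha
      | zero =>
        have hz (x : Eucl q) {γ : Fin (q + 1) → T.Arrow} (hγ : T.IsLoop x γ) :
            T.loopTerm x (Function.update f k 0) γ = 0 := by
          simpa using hγ.loopTerm_update_smul (f := f) hT k 0 T.smoothAlg.zero_mem
        refine ⟨fun x hx => ?_, ?_⟩
        · convert Set.finite_empty
          exact eq_empty_of_forall_notMem fun γ hγ => hγ.2 (hz x hγ.1)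
        · refine (integrableOn_zero (ε' := ℂ)).congr_fun (fun x _ => ?_)
            T.isOpen_domain.measurableSet
          exact (finsum_eq_zero_of_forall_eq_zero fun γ => hz x γ.2).symm
      | add a b ha hb ha' hb' => exact ha'.update_add hT k ha hb hb'
      | smul c a ha ha' => exact ha'.update_smul hT k c ha
  exact key Finset.univ f hf fun j hj => absurd (Finset.mem_univ j) hj

end Multilinear

end Foliation.Transversal

/-! ### Differential forms on a normed space -/

section WedgeAt

open ContinuousAlternatingMap (ofSubsingleton ofSubsingletonLIE alternatizeUncurryFin
  alternatizeUncurryFin_apply alternatizeUncurryFinCLM)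

variable {V W : Type*} [NormedAddCommGroup V] [NormedSpace ℝ V]
  [NormedAddCommGroup W] [NormedSpace ℝ W] {k : ℕ}

/-- The `1`-covector given by a linear functional. -/
noncomputable abbrev oneForm (a : V →L[ℝ] ℝ) : V [⋀^Fin 1]→L[ℝ] ℝ :=
  ofSubsingleton ℝ V ℝ (0 : Fin 1) a

/-- The wedge product of a `1`-covector and a `k`-covector; `MForm.wedge` is its fibrewise
version. -/
noncomputable def wedgeAt (a : V [⋀^Fin 1]→L[ℝ] ℝ) (b : V [⋀^Fin k]→L[ℝ] ℝ) :
    V [⋀^Fin (k + 1)]→L[ℝ] ℝ :=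
  alternatizeUncurryFin (((ofSubsingleton ℝ V ℝ (0 : Fin 1)).symm a).smulRight b)

theorem wedgeAt_apply (a : V [⋀^Fin 1]→L[ℝ] ℝ) (b : V [⋀^Fin k]→L[ℝ] ℝ) (v : Fin (k + 1) → V) :
    wedgeAt a b v =
      ∑ i : Fin (k + 1), (-1 : ℝ) ^ (i : ℕ) * (a (fun _ => v i) * b (i.removeNth v)) := by
  rw [wedgeAt, alternatizeUncurryFin_apply]
  refine Finset.sum_congr rfl fun i _ => ?_
  simp

theorem wedgeAt_one_apply (a b : V [⋀^Fin 1]→L[ℝ] ℝ) (v : Fin 2 → V) :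
    wedgeAt a b v = a (fun _ => v 0) * b (fun _ => v 1) - a (fun _ => v 1) * b (fun _ => v 0) := by
  have h0 : (0 : Fin 2).removeNth v = fun _ => v 1 := by
    ext i; fin_cases i; rfl
  have h1 : (1 : Fin 2).removeNth v = fun _ => v 0 := by
    ext i; fin_cases i; rfl
  rw [wedgeAt_apply, Fin.sum_univ_two, h0, h1]
  simp
  ring

theorem wedgeAt_two_apply (a : V [⋀^Fin 1]→L[ℝ] ℝ) (b : V [⋀^Fin 2]→L[ℝ] ℝ) (v : Fin 3 → V) :
    wedgeAt a b v = a (fun _ => v 0) * b ![v 1, v 2] - a (fun _ => v 1) * b ![v 0, v 2] +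
      a (fun _ => v 2) * b ![v 0, v 1] := by
  have h0 : (0 : Fin 3).removeNth v = ![v 1, v 2] := by
    ext i; fin_cases i <;> rfl
  have h1 : (1 : Fin 3).removeNth v = ![v 0, v 2] := by
    ext i; fin_cases i <;> rfl
  have h2 : (2 : Fin 3).removeNth v = ![v 0, v 1] := by
    ext i; fin_cases i <;> rfl
  rw [wedgeAt_apply, Fin.sum_univ_three, h0, h1, h2]
  simp
  ring

theorem wedgeAt_compContinuousLinearMap (a : V [⋀^Fin 1]→L[ℝ] ℝ) (b : V [⋀^Fin k]→L[ℝ] ℝ)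
    (L : W →L[ℝ] V) : (wedgeAt a b).compContinuousLinearMap L =
      wedgeAt (a.compContinuousLinearMap L) (b.compContinuousLinearMap L) := by
  ext v
  simp only [ContinuousAlternatingMap.compContinuousLinearMap_apply, wedgeAt_apply]
  rfl

theorem sub_wedgeAt (a a' : V [⋀^Fin 1]→L[ℝ] ℝ) (b : V [⋀^Fin k]→L[ℝ] ℝ) :
    wedgeAt (a - a') b = wedgeAt a b - wedgeAt a' b := by
  ext v
  simp [wedgeAt_apply, sub_mul, mul_sub]

theorem smul_wedgeAt (c : ℝ) (a : V [⋀^Fin 1]→L[ℝ] ℝ) (b : V [⋀^Fin k]→L[ℝ] ℝ) :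
    wedgeAt (c • a) b = c • wedgeAt a b := by
  ext v
  simp only [wedgeAt_apply, ContinuousAlternatingMap.smul_apply, smul_eq_mul, Finset.mul_sum]
  exact Finset.sum_congr rfl fun i _ => by ring

theorem wedgeAt_zero (a : V [⋀^Fin 1]→L[ℝ] ℝ) :
    wedgeAt a (0 : V [⋀^Fin k]→L[ℝ] ℝ) = 0 := by
  ext v
  simp [wedgeAt_apply]

theorem wedgeAt_wedgeAt_self (a b : V [⋀^Fin 1]→L[ℝ] ℝ) : wedgeAt a (wedgeAt b a) = 0 := by
  ext v
  simp only [wedgeAt_two_apply, wedgeAt_one_apply, Matrix.cons_val_zero, Matrix.cons_val_one]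
  change _ = (0 : ℝ)
  ring

/-- Covectors whose wedge product vanishes are linearly dependent. -/
theorem exists_eq_smul_of_wedgeAt_eq_zero {a b : V [⋀^Fin 1]→L[ℝ] ℝ} (h : wedgeAt a b = 0)
    (hb : b ≠ 0) : ∃ c : ℝ, a = c • b := by
  obtain ⟨w, hw⟩ : ∃ w, b (fun _ => w) ≠ 0 := by
    by_contra! hcon
    refine hb (ContinuousAlternatingMap.ext fun v => ?_)
    rw [show v = fun _ => v 0 from funext fun i => by fin_cases i; rfl, hcon]
    rfl
  refine ⟨a (fun _ => w) / b (fun _ => w), ContinuousAlternatingMap.ext fun v => ?_⟩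
  have h1 := DFunLike.congr_fun h ![v 0, w]
  simp only [wedgeAt_one_apply, Matrix.cons_val_zero, Matrix.cons_val_one] at h1
  change _ = (0 : ℝ) at h1
  rw [show v = fun _ => v 0 from funext fun i => by fin_cases i; rfl,
    ContinuousAlternatingMap.smul_apply, smul_eq_mul]
  field_simp
  linarith

theorem ContDiffOn.wedgeAt {n : WithTop ℕ∞} {s : Set V} {α : V → V [⋀^Fin 1]→L[ℝ] ℝ}
    {β : V → V [⋀^Fin k]→L[ℝ] ℝ} (hα : ContDiffOn ℝ n α s) (hβ : ContDiffOn ℝ n β s) :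
    ContDiffOn ℝ n (fun y => wedgeAt (α y) (β y)) s := by
  have h1 := ((ofSubsingletonLIE (𝕜 := ℝ) (E := V) (F := ℝ) (0 : Fin 1)).symm.contDiff
    (n := n)).comp_contDiffOn hα
  exact (alternatizeUncurryFinCLM ℝ V ℝ).contDiff.comp_contDiffOn (h1.smulRight hβ)

theorem DifferentiableAt.wedgeAt {x : V} {α : V → V [⋀^Fin 1]→L[ℝ] ℝ}
    {β : V → V [⋀^Fin k]→L[ℝ] ℝ} (hα : DifferentiableAt ℝ α x) (hβ : DifferentiableAt ℝ β x) :
    DifferentiableAt ℝ (fun y => _root_.wedgeAt (α y) (β y)) x := by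
  have h1 := (ofSubsingletonLIE (𝕜 := ℝ) (E := V) (F := ℝ) (0 : Fin 1)).symm
    |>.differentiableAt.comp x hα
  have h2 := (IsBoundedBilinearMap.differentiableAt (𝕜 := ℝ) (E := V →L[ℝ] ℝ)
    (F := V [⋀^Fin k]→L[ℝ] ℝ) (G := V →L[ℝ] V [⋀^Fin k]→L[ℝ] ℝ) (b := fun p => p.1.smulRight p.2)
    isBoundedBilinearMap_smulRight (_, β x)).comp x (h1.prodMk hβ)
  exact (alternatizeUncurryFinCLM ℝ V ℝ).differentiableAt.comp x h2

theorem extDeriv_one_apply {x : V} {α : V → V [⋀^Fin 1]→L[ℝ] ℝ} (hα : DifferentiableAt ℝ α x)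
    (v : Fin 2 → V) : extDeriv α x v =
      fderiv ℝ (fun y => α y fun _ => v 1) x (v 0) -
        fderiv ℝ (fun y => α y fun _ => v 0) x (v 1) := by
  have h0 : (0 : Fin 2).removeNth v = fun _ => v 1 := by
    ext i; fin_cases i; rfl
  have h1 : (1 : Fin 2).removeNth v = fun _ => v 0 := by
    ext i; fin_cases i; rfl
  rw [extDeriv_apply hα, Fin.sum_univ_two, h0, h1]
  simp
  ring

/-- The Leibniz rule for the wedge product of two `1`-forms. -/
theorem extDeriv_wedgeAt {x : V} {α β : V → V [⋀^Fin 1]→L[ℝ] ℝ} (hα : DifferentiableAt ℝ α x)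
    (hβ : DifferentiableAt ℝ β x) : extDeriv (fun y => wedgeAt (α y) (β y)) x =
      wedgeAt (β x) (extDeriv α x) - wedgeAt (α x) (extDeriv β x) := by
  ext v
  have h0 : (0 : Fin 3).removeNth v = ![v 1, v 2] := by
    ext i; fin_cases i <;> rfl
  have h1 : (1 : Fin 3).removeNth v = ![v 0, v 2] := by
    ext i; fin_cases i <;> rfl
  have h2 : (2 : Fin 3).removeNth v = ![v 0, v 1] := by
    ext i; fin_cases i <;> rfl
  have hval {γ : V → V [⋀^Fin 1]→L[ℝ] ℝ} (hγ : DifferentiableAt ℝ γ x) (w : V) :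
      DifferentiableAt ℝ (fun y => γ y fun _ => w) x :=
    hγ.continuousAlternatingMap_apply_const fun _ => w
  have hd (a b w : V) : fderiv ℝ (fun y => wedgeAt (α y) (β y) ![a, b]) x w =
      (fderiv ℝ (fun y => α y fun _ => a) x w * β x (fun _ => b) +
        α x (fun _ => a) * fderiv ℝ (fun y => β y fun _ => b) x w) -
      (fderiv ℝ (fun y => α y fun _ => b) x w * β x (fun _ => a) +
        α x (fun _ => b) * fderiv ℝ (fun y => β y fun _ => a) x w) := by
    simp only [wedgeAt_one_apply, Matrix.cons_val_zero, Matrix.cons_val_one]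
    rw [fderiv_fun_sub ((hval hα a).fun_mul (hval hβ b)) ((hval hα b).fun_mul (hval hβ a)),
      fderiv_fun_mul (hval hα a) (hval hβ b), fderiv_fun_mul (hval hα b) (hval hβ a)]
    simp
    ring
  rw [extDeriv_apply (hα.wedgeAt hβ), Fin.sum_univ_three, h0, h1, h2, hd, hd, hd,
    ContinuousAlternatingMap.sub_apply, wedgeAt_two_apply, wedgeAt_two_apply]
  simp only [extDeriv_one_apply hα, extDeriv_one_apply hβ, Matrix.cons_val_zero,
    Matrix.cons_val_one]
  simp
  ring

theorem differentiableAt_fderiv {x : V} {s : V → ℝ} (hs : ContDiffAt ℝ ∞ s x) :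
    DifferentiableAt ℝ (fderiv ℝ s) x :=
  (hs.fderiv_right (m := 1) (by norm_cast)).differentiableAt (by simp)

theorem fderiv_fderiv_apply {x : V} {s : V → ℝ} (hs : ContDiffAt ℝ ∞ s x) (w v : V) :
    fderiv ℝ (fun y => fderiv ℝ s y v) x w = fderiv ℝ (fderiv ℝ s) x w v := by
  rw [fderiv_clm_apply (differentiableAt_fderiv hs) (differentiableAt_const v)]
  simp

theorem fderiv_fderiv_comm {x : V} {s : V → ℝ} (hs : ContDiffAt ℝ ∞ s x) (w v : V) :
    fderiv ℝ (fderiv ℝ s) x w v = fderiv ℝ (fderiv ℝ s) x v w :=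
  (hs.isSymmSndFDerivAt (by simpa using ENat.LEInfty.out)).eq w v

theorem differentiableAt_oneForm {x : V} {a : V → V →L[ℝ] ℝ} (ha : DifferentiableAt ℝ a x) :
    DifferentiableAt ℝ (fun y => oneForm (a y)) x :=
  (ofSubsingletonLIE (𝕜 := ℝ) (E := V) (F := ℝ) (0 : Fin 1)).differentiableAt.comp x ha

theorem extDeriv_oneForm_fderiv {x : V} {s : V → ℝ} (hs : ContDiffAt ℝ ∞ s x) :
    extDeriv (fun y => oneForm (fderiv ℝ s y)) x = 0 := by
  ext v
  rw [extDeriv_one_apply (differentiableAt_oneForm (differentiableAt_fderiv hs))]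
  simp only [ContinuousAlternatingMap.ofSubsingleton_apply_apply, fderiv_fderiv_apply hs]
  rw [fderiv_fderiv_comm hs, sub_self]
  rfl

/-- `d (f ds) = (d log f) ∧ f ds`. -/
theorem extDeriv_oneForm_smul_fderiv {x : V} {f s : V → ℝ} (hf : DifferentiableAt ℝ f x)
    (hfx : f x ≠ 0) (hs : ContDiffAt ℝ ∞ s x) :
    extDeriv (fun y => oneForm (f y • fderiv ℝ s y)) x =
      wedgeAt (oneForm (fderiv ℝ (fun y => Real.log (f y)) x)) (oneForm (f x • fderiv ℝ s x)) := by
  have hds := differentiableAt_fderiv hs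
  ext v
  have hd (a w : V) : fderiv ℝ (fun y => f y * fderiv ℝ s y a) x w =
      fderiv ℝ f x w * fderiv ℝ s x a + f x * fderiv ℝ (fderiv ℝ s) x w a := by
    rw [fderiv_fun_mul hf (hds.clm_apply (differentiableAt_const a))]
    simp only [_root_.add_apply, _root_.smul_apply, smul_eq_mul, fderiv_fderiv_apply hs]
    ring
  rw [extDeriv_one_apply (differentiableAt_oneForm (hf.fun_smul hds)), wedgeAt_one_apply,
    fderiv.log hf hfx]
  simp only [ContinuousAlternatingMap.ofSubsingleton_apply_apply, _root_.smul_apply, smul_eq_mul,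
    hd]
  rw [fderiv_fderiv_comm hs (v 1) (v 0)]
  field_simp
  ring

/-- The computation of the Godbillon–Vey form: if `κ` is closed, `η - κ` is a multiple of `ρ`, and
`dρ = η ∧ ρ`, then `η ∧ dη = d (η ∧ κ)`. Indeed `0 = d ((η - κ) ∧ ρ) = ρ ∧ dη` because
`(η - κ) ∧ dρ` has the factor `ρ` twice, and therefore `(η - κ) ∧ dη = 0`. -/
theorem extDeriv_wedgeAt_eq_of_closed {x : V} {ρ η κ : V → V [⋀^Fin 1]→L[ℝ] ℝ}
    (hρ : DifferentiableAt ℝ ρ x) (hη : DifferentiableAt ℝ η x) (hκ : DifferentiableAt ℝ κ x)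
    (hρx : ρ x ≠ 0) (hdρ : extDeriv ρ x = wedgeAt (η x) (ρ x)) (hdκ : extDeriv κ x = 0)
    (h : ∀ᶠ y in 𝓝 x, wedgeAt (η y - κ y) (ρ y) = 0) :
    extDeriv (fun y => wedgeAt (η y) (κ y)) x = wedgeAt (η x) (extDeriv η x) := by
  obtain ⟨c, hc⟩ := exists_eq_smul_of_wedgeAt_eq_zero h.self_of_nhds hρx
  have hdμ : extDeriv (fun y => η y - κ y) x = extDeriv η x := by
    have h1 := extDeriv_fun_add (hη.fun_sub hκ) hκ
    simp only [sub_add_cancel, hdκ, add_zero] at h1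
    exact h1.symm
  have h2 : wedgeAt (ρ x) (extDeriv η x) = 0 := by
    have h3 := extDeriv_wedgeAt (hη.fun_sub hκ) hρ
    rw [Filter.EventuallyEq.extDeriv_eq (ω₂ := fun _ => 0) h] at h3
    have h4 : extDeriv (fun _ : V => (0 : V [⋀^Fin 2]→L[ℝ] ℝ)) x = 0 := by
      ext v
      rw [extDeriv_apply (differentiableAt_const _)]
      simp
    have h5 : wedgeAt (η x - κ x) (extDeriv ρ x) = 0 := by
      rw [hc, hdρ, smul_wedgeAt, wedgeAt_wedgeAt_self, smul_zero]
    rw [h4, h5, sub_zero] at h3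
    rw [← hdμ]
    exact h3.symm
  have h6 : wedgeAt (η x - κ x) (extDeriv η x) = 0 := by rw [hc, smul_wedgeAt, h2, smul_zero]
  rw [extDeriv_wedgeAt hη hκ, hdκ, wedgeAt_zero, sub_zero]
  rw [sub_wedgeAt, sub_eq_zero] at h6
  exact h6.symm

end WedgeAt

/-! ### Differential forms in charts -/

section Charts

variable {V : Type*} [NormedAddCommGroup V] [NormedSpace ℝ V]
  {M : Type*} [TopologicalSpace M] [ChartedSpace V M] {k : ℕ}
  {e e' : OpenPartialHomeomorph M V}

/-- The derivative of a chart at `x`, as an endomorphism of `V`: all tangent spaces are copies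
of `V`. -/
noncomputable def chartDeriv (e : OpenPartialHomeomorph M V) (x : M) : V →L[ℝ] V :=
  mfderiv 𝓘(ℝ, V) 𝓘(ℝ, V) e x

/-- The derivative of the inverse of a chart at `y`, as an endomorphism of `V`. -/
noncomputable def chartSymmDeriv (e : OpenPartialHomeomorph M V) (y : V) : V →L[ℝ] V :=
  mfderiv 𝓘(ℝ, V) 𝓘(ℝ, V) e.symm y

theorem contDiffAt_transition (he : e ∈ IsManifold.maximalAtlas 𝓘(ℝ, V) ∞ M)
    (he' : e' ∈ IsManifold.maximalAtlas 𝓘(ℝ, V) ∞ M) {y : V} (hy : y ∈ e.target)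
    (hy' : e.symm y ∈ e'.source) : ContDiffAt ℝ ∞ (fun z => e' (e.symm z)) y :=
  contMDiffAt_iff_contDiffAt.1 ((contMDiffAt_of_mem_maximalAtlas he' hy').comp y
    (contMDiffAt_symm_of_mem_maximalAtlas he hy))

theorem chartDeriv_chartSymmDeriv (he : e ∈ IsManifold.maximalAtlas 𝓘(ℝ, V) ∞ M)
    (he' : e' ∈ IsManifold.maximalAtlas 𝓘(ℝ, V) ∞ M) {y : V} (hy : y ∈ e.target)
    (hy' : e.symm y ∈ e'.source) (v : V) :
    chartDeriv e' (e.symm y) (chartSymmDeriv e y v) = fderiv ℝ (fun z => e' (e.symm z)) y v := by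
  have h := mfderiv_comp y
    ((contMDiffAt_of_mem_maximalAtlas he' hy').mdifferentiableAt (by simp))
    ((contMDiffAt_symm_of_mem_maximalAtlas he hy).mdifferentiableAt (by simp))
  rw [mfderiv_eq_fderiv] at h
  exact (DFunLike.congr_fun h v).symm

theorem mdifferentiable_of_mem_maximalAtlas (he : e ∈ IsManifold.maximalAtlas 𝓘(ℝ, V) ∞ M) :
    e.MDifferentiable 𝓘(ℝ, V) 𝓘(ℝ, V) :=
  ⟨(contMDiffOn_of_mem_maximalAtlas he).mdifferentiableOn (by simp),
    (contMDiffOn_symm_of_mem_maximalAtlas he).mdifferentiableOn (by simp)⟩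

theorem chartSymmDeriv_chartDeriv (he : e ∈ IsManifold.maximalAtlas 𝓘(ℝ, V) ∞ M) {x : M}
    (hx : x ∈ e.source) (v : V) : chartSymmDeriv e (e x) (chartDeriv e x v) = v :=
  DFunLike.congr_fun ((mdifferentiable_of_mem_maximalAtlas he).symm_comp_deriv hx) v

theorem chartDeriv_chartSymmDeriv_self (he : e ∈ IsManifold.maximalAtlas 𝓘(ℝ, V) ∞ M) {y : V}
    (hy : y ∈ e.target) (v : V) : chartDeriv e (e.symm y) (chartSymmDeriv e y v) = v :=
  DFunLike.congr_fun ((mdifferentiable_of_mem_maximalAtlas he).comp_symm_deriv hy) v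

theorem chartDeriv_eq (he : e ∈ IsManifold.maximalAtlas 𝓘(ℝ, V) ∞ M)
    (he' : e' ∈ IsManifold.maximalAtlas 𝓘(ℝ, V) ∞ M) {x : M} (hx : x ∈ e.source)
    (hx' : x ∈ e'.source) (v : V) :
    chartDeriv e' x v = fderiv ℝ (fun z => e' (e.symm z)) (e x) (chartDeriv e x v) := by
  have h := chartDeriv_chartSymmDeriv he he' (e.map_source hx) (by rwa [e.left_inv hx])
    (chartDeriv e x v)
  rwa [chartSymmDeriv_chartDeriv he hx, e.left_inv hx] at h

namespace MForm

/-- The value of a form at `x`, as an alternating form on the model space. -/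
def val (α : MForm V M k) (x : M) : V [⋀^Fin k]→L[ℝ] ℝ := α x

theorem inChart_eq (α : MForm V M k) (e : OpenPartialHomeomorph M V) (y : V) :
    α.inChart e y = (α.val (e.symm y)).compContinuousLinearMap (chartSymmDeriv e y) := rfl

theorem d_val (α : MForm V M k) (x : M) :
    α.d.val x = (extDeriv (α.inChart (chartAt V x)) (chartAt V x x)).compContinuousLinearMap
      (chartDeriv (chartAt V x) x) := rfl

theorem wedge_val (α : MForm V M 1) (β : MForm V M k) (x : M) :
    (α.wedge β).val x = wedgeAt (α.val x) (β.val x) := rfl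

theorem wedge_inChart (α : MForm V M 1) (β : MForm V M k) (e : OpenPartialHomeomorph M V) :
    (α.wedge β).inChart e = fun y => wedgeAt (α.inChart e y) (β.inChart e y) := by
  ext1 y
  rw [inChart_eq, wedge_val, wedgeAt_compContinuousLinearMap]
  rfl

theorem inChart_compContinuousLinearMap (α : MForm V M k)
    (he : e ∈ IsManifold.maximalAtlas 𝓘(ℝ, V) ∞ M) {x : M} (hx : x ∈ e.source) :
    (α.inChart e (e x)).compContinuousLinearMap (chartDeriv e x) = α.val x := by
  ext v
  rw [inChart_eq, e.left_inv hx]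
  simp only [ContinuousAlternatingMap.compContinuousLinearMap_apply]
  congr 1
  ext i
  exact chartSymmDeriv_chartDeriv he hx (v i)

theorem IsSmooth.wedge {α : MForm V M 1} {β : MForm V M k} (hα : α.IsSmooth)
    (hβ : β.IsSmooth) : (α.wedge β).IsSmooth := by
  intro c
  rw [wedge_inChart]
  exact (hα c).wedgeAt (hβ c)

theorem IsSmooth.contDiffAt {α : MForm V M k} (hα : α.IsSmooth) (c : M) {y : V}
    (hy : y ∈ (chartAt V c).target) : ContDiffAt ℝ ∞ (α.inChart (chartAt V c)) y :=
  (hα c).contDiffAt ((chartAt V c).open_target.mem_nhds hy)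

/-- In the preferred chart at `x`, and at `x` itself, the exterior derivative of forms on `M` is the
one of the model space. -/
theorem extDeriv_inChart_self [IsManifold 𝓘(ℝ, V) ∞ M] (α : MForm V M k) (x : M) :
    extDeriv (α.inChart (chartAt V x)) (chartAt V x x) =
      α.d.inChart (chartAt V x) (chartAt V x x) := by
  ext v
  rw [inChart_eq, (chartAt V x).left_inv (mem_chart_source V x), d_val]
  simp only [ContinuousAlternatingMap.compContinuousLinearMap_apply]
  congr 1
  ext i
  have h := chartDeriv_chartSymmDeriv_self (IsManifold.chart_mem_maximalAtlas (I := 𝓘(ℝ, V))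
    (n := ∞) x) (mem_chart_target V x) (v i)
  rw [(chartAt V x).left_inv (mem_chart_source V x)] at h
  exact h.symm

end MForm

end Charts

/-! ### Transverse coordinates of a foliation -/

namespace Foliation

section Tangent

variable {p q : ℕ} {M : Type*} [TopologicalSpace M] [ChartedSpace (FolModel p q) M]
  {F : Foliation p q M} {e e' : OpenPartialHomeomorph M (FolModel p q)} {x : M}

/-- If the transverse coordinate of `e'` is locally a function of the one of `e`, then its
derivative vanishes on the kernel of the derivative of the latter. No regularity of the
function is needed. -/
theorem chartDeriv_snd_eq_zero (he : e ∈ IsManifold.maximalAtlas 𝓘(ℝ, FolModel p q) ∞ M)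
    (he' : e' ∈ IsManifold.maximalAtlas 𝓘(ℝ, FolModel p q) ∞ M) (hx : x ∈ e.source)
    (hx' : x ∈ e'.source) {g : Eucl q → Eucl q}
    (hg : ∀ᶠ w in 𝓝 (e x), (e' (e.symm w)).2 = g w.2) {v : FolModel p q}
    (hv : (chartDeriv e x v).2 = 0) : (chartDeriv e' x v).2 = 0 := by
  rw [chartDeriv_eq he he' hx hx']
  set u := chartDeriv e x v
  have hd : HasFDerivAt (fun z => e' (e.symm z)) (fderiv ℝ (fun z => e' (e.symm z)) (e x))
      (e x + (0 : ℝ) • u) := by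
    rw [zero_smul, add_zero]
    exact ((contDiffAt_transition he he' (e.map_source hx)
      (by rwa [e.left_inv hx])).differentiableAt (by simp)).hasFDerivAt
  have hline : HasDerivAt (fun s : ℝ => e x + s • u) u 0 := by
    simpa using ((hasDerivAt_id (0 : ℝ)).smul_const u).const_add (e x)
  have h1 : HasDerivAt (fun s : ℝ => (e' (e.symm (e x + s • u))).2)
      (fderiv ℝ (fun z => e' (e.symm z)) (e x) u).2 0 :=
    (ContinuousLinearMap.snd ℝ (Eucl p) (Eucl q)).hasFDerivAt.comp_hasDerivAt 0
      (HasFDerivAt.comp_hasDerivAt (f := fun s : ℝ => e x + s • u) 0 hd hline)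
  have h2 : (fun s : ℝ => (e' (e.symm (e x + s • u))).2) =ᶠ[𝓝 0] fun _ => g (e x).2 := by
    have hc : Tendsto (fun s : ℝ => e x + s • u) (𝓝 0) (𝓝 (e x)) := by
      simpa using hline.continuousAt.tendsto
    filter_upwards [hc.eventually hg] with s hs
    rw [hs]
    simp [hv]
  exact h1.unique ((hasDerivAt_const (0 : ℝ) _).congr_of_eventuallyEq h2)

/-- The tangent spaces of the leaves can be computed in any foliation chart. -/
theorem mem_tangent_iff (hF : F.IsFoliationChart e) (hx : x ∈ e.source)
    (v : TangentSpace 𝓘(ℝ, FolModel p q) x) :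
    v ∈ F.tangent x ↔ (chartDeriv e x v).2 = 0 := by
  have hmem : v ∈ F.tangent x ↔ ∀ e' ∈ F.atlas, x ∈ e'.source → (chartDeriv e' x v).2 = 0 := by
    simp only [tangent, Submodule.mem_iInf]
    rfl
  have hsrc {e₁ e₂ : OpenPartialHomeomorph M (FolModel p q)} (h1 : x ∈ e₁.source)
      (h2 : x ∈ e₂.source) : e₁ x ∈ (e₁.symm.trans e₂).source := by
    simp [h1, h2]
  rw [hmem]
  constructor
  · intro h
    obtain ⟨e', he', hx'⟩ := F.cover x
    obtain ⟨g, hg⟩ := (hF.2 e' he').2 (e' x) (hsrc hx' hx)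
    exact chartDeriv_snd_eq_zero (F.smooth he') hF.1 hx' hx hg (h e' he' hx')
  · intro h e' he' hx'
    obtain ⟨g, hg⟩ := (hF.2 e' he').1 (e x) (hsrc hx hx')
    exact chartDeriv_snd_eq_zero hF.1 (F.smooth he') hx hx' hg h

end Tangent

/-! ### Codimension one: the logarithmic derivative of a defining form -/

section CodimOne

variable {p : ℕ} {M : Type*} [TopologicalSpace M] [ChartedSpace (FolModel p 1) M]
  {F : Foliation p 1 M} {e e' : OpenPartialHomeomorph M (FolModel p 1)} {x : M}
  {ρ : MForm (FolModel p 1) M 1}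

/-- The unit vector in the transverse direction of `ℝᵖ × ℝ`. -/
noncomputable def transDir (p : ℕ) : FolModel p 1 := (0, EuclideanSpace.single 0 1)

/-- The transverse coordinate on `ℝᵖ × ℝ`. -/
noncomputable def transCoord (p : ℕ) : FolModel p 1 →L[ℝ] ℝ :=
  (EuclideanSpace.proj (0 : Fin 1)).comp (ContinuousLinearMap.snd ℝ (Eucl p) (Eucl 1))

theorem transCoord_apply (w : FolModel p 1) : transCoord p w = w.2 0 := rfl

theorem transCoord_transDir : transCoord p (transDir p) = 1 := by
  simp [transCoord_apply, transDir]

theorem transCoord_eq_zero_iff {w : FolModel p 1} : transCoord p w = 0 ↔ w.2 = 0 := by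
  rw [transCoord_apply]
  refine ⟨fun h => ?_, fun h => by simp [h]⟩
  ext i
  fin_cases i
  exact h

/-- The function `f` with `ρ = f dy` on the domain of the chart `e`, where `y` is the transverse
coordinate of `e`. -/
noncomputable def transCoeff (ρ : MForm (FolModel p 1) M 1)
    (e : OpenPartialHomeomorph M (FolModel p 1)) (x : M) : ℝ :=
  ρ.val x fun _ => chartSymmDeriv e (e x) (transDir p)

/-- `ρ = f dy`: both sides have the tangent spaces of the leaves as kernels, and they agree on the
transverse direction. -/
theorem val_eq_transCoeff_mul
    (hρ : ∀ (x : M) (v : TangentSpace 𝓘(ℝ, FolModel p 1) x),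
      ρ x (fun _ => v) = 0 ↔ v ∈ F.tangent x)
    (he : F.IsFoliationChart e) (hx : x ∈ e.source) (v : FolModel p 1) :
    ρ.val x (fun _ => v) = transCoeff ρ e x * transCoord p (chartDeriv e x v) := by
  let r : FolModel p 1 →L[ℝ] ℝ :=
    (ContinuousAlternatingMap.ofSubsingleton ℝ (FolModel p 1) ℝ (0 : Fin 1)).symm (ρ.val x)
  have hr (w : FolModel p 1) : ρ.val x (fun _ => w) = r w := rfl
  set b := chartSymmDeriv e (e x) (transDir p) with hb
  have hself : chartDeriv e x b = transDir p := by
    have := chartDeriv_chartSymmDeriv_self he.1 (e.map_source hx) (transDir p)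
    rwa [e.left_inv hx] at this
  have h0 : ρ.val x (fun _ => v - transCoord p (chartDeriv e x v) • b) = 0 := by
    refine (hρ x _).2 ((mem_tangent_iff he hx _).2 (transCoord_eq_zero_iff.1 ?_))
    rw [map_sub, map_smul, hself, map_sub, map_smul, transCoord_transDir]
    simp
  rw [hr, map_sub, map_smul, sub_eq_zero] at h0
  rw [hr, h0, transCoeff, ← hb, hr, smul_eq_mul, mul_comm]

theorem transCoeff_ne_zero
    (hρ : ∀ (x : M) (v : TangentSpace 𝓘(ℝ, FolModel p 1) x),
      ρ x (fun _ => v) = 0 ↔ v ∈ F.tangent x)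
    (he : F.IsFoliationChart e) (hx : x ∈ e.source) : transCoeff ρ e x ≠ 0 := by
  intro h
  have h1 := transCoord_eq_zero_iff.2 ((mem_tangent_iff he hx _).1 ((hρ x _).1 h))
  have := chartDeriv_chartSymmDeriv_self he.1 (e.map_source hx) (transDir p)
  rw [e.left_inv hx] at this
  rw [this, transCoord_transDir] at h1
  exact one_ne_zero h1

/-- An affine change of the transverse coordinate changes the coefficient of `ρ` by a locally
constant factor. -/
theorem exists_transCoeff_eventually_eq
    (hρ : ∀ (x : M) (v : TangentSpace 𝓘(ℝ, FolModel p 1) x),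
      ρ x (fun _ => v) = 0 ↔ v ∈ F.tangent x)
    (he : F.IsFoliationChart e) (he' : F.IsFoliationChart e') (hx : x ∈ e.source)
    (hx' : x ∈ e'.source) {A : Eucl 1 →ᵃ[ℝ] Eucl 1}
    (hA : ∀ᶠ w in 𝓝 (e x), (e' (e.symm w)).2 = A w.2) :
    ∃ a : ℝ, ∀ᶠ z in 𝓝 x, transCoeff ρ e z = transCoeff ρ e' z * a := by
  refine ⟨A.linear (EuclideanSpace.single 0 1) 0, ?_⟩
  filter_upwards [e.open_source.mem_nhds hx, e'.open_source.mem_nhds hx',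
    (e.continuousAt hx).eventually (eventually_eventually_nhds.2 hA)] with z hz hz' hAz
  rw [transCoeff, val_eq_transCoeff_mul hρ he' hz']
  have h1 := chartDeriv_chartSymmDeriv he.1 he'.1 (e.map_source hz)
    (by rwa [e.left_inv hz]) (transDir p)
  rw [e.left_inv hz] at h1
  rw [h1, transCoord_apply]
  have hd := ((contDiffAt_transition he.1 he'.1 (e.map_source hz)
      (by rwa [e.left_inv hz])).differentiableAt (by simp)).hasFDerivAt
  have h2 := ((ContinuousLinearMap.snd ℝ (Eucl p) (Eucl 1)).hasFDerivAt.comp (e z) hd)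
  have h3 := ((A.hasFDerivAt_of_finiteDimensional (e z).2).comp (e z)
    (ContinuousLinearMap.snd ℝ (Eucl p) (Eucl 1)).hasFDerivAt)
  have h4 := DFunLike.congr_fun (h2.unique (h3.congr_of_eventuallyEq hAz)) (transDir p)
  exact congrArg (fun w : Eucl 1 => transCoeff ρ e' z * w 0) h4

variable [IsManifold 𝓘(ℝ, FolModel p 1) ∞ M]

theorem contDiffAt_transCoeff (hρs : ρ.IsSmooth)
    (he : e ∈ IsManifold.maximalAtlas 𝓘(ℝ, FolModel p 1) ∞ M) (c : M) {y : FolModel p 1}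
    (hy : y ∈ (chartAt (FolModel p 1) c).target)
    (hye : (chartAt (FolModel p 1) c).symm y ∈ e.source) :
    ContDiffAt ℝ ∞ (fun z => transCoeff ρ e ((chartAt (FolModel p 1) c).symm z)) y := by
  set φ := chartAt (FolModel p 1) c with hφ_def
  have hφ : φ ∈ IsManifold.maximalAtlas 𝓘(ℝ, FolModel p 1) ∞ M :=
    IsManifold.chart_mem_maximalAtlas c
  have h1 : ContDiffAt ℝ ∞ (fun z => (ContinuousAlternatingMap.ofSubsingletonLIE (𝕜 := ℝ)
      (E := FolModel p 1) (F := ℝ) (0 : Fin 1)).symm (ρ.inChart φ z)) y :=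
    (LinearIsometryEquiv.contDiff _).contDiffAt.comp y (hρs.contDiffAt c hy)
  have h2 : ContDiffAt ℝ ∞ (fun z => fderiv ℝ (fun w => φ (e.symm w)) (e (φ.symm z))) y := by
    have h3 : ContDiffAt ℝ ∞ (fun w => φ (e.symm w)) (e (φ.symm y)) :=
      contDiffAt_transition he hφ (e.map_source hye) (by
        rw [e.left_inv hye]; exact φ.map_target hy)
    exact (h3.fderiv_right (m := ∞) (by simp)).comp y (contDiffAt_transition hφ he hy hye)
  refine (h1.clm_apply (h2.clm_apply contDiffAt_const)).congr_of_eventuallyEq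
    (f := fun z => (ContinuousAlternatingMap.ofSubsingletonLIE (𝕜 := ℝ)
      (E := FolModel p 1) (F := ℝ) (0 : Fin 1)).symm (ρ.inChart φ z)
        (fderiv ℝ (fun w => φ (e.symm w)) (e (φ.symm z)) (transDir p))) ?_
  filter_upwards [φ.open_target.mem_nhds hy,
    (φ.symm.continuousAt hy).eventually (e.open_source.mem_nhds hye)] with z hz hze
  change _ = ρ.inChart φ z (fun _ => _)
  rw [MForm.inChart_eq, ContinuousAlternatingMap.compContinuousLinearMap_apply, transCoeff]
  congr 1
  ext1 i
  have h4 := chartDeriv_chartSymmDeriv he hφ (e.map_source hze)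
    (by rw [e.left_inv hze]; exact φ.map_target hz) (transDir p)
  rw [e.left_inv hze] at h4
  have h5 := chartSymmDeriv_chartDeriv hφ (φ.map_target hz)
    (chartSymmDeriv e (e (φ.symm z)) (transDir p))
  rw [φ.right_inv hz, h4] at h5
  exact h5.symm

/-- For each point `x` choose a chart `ε x` around it. The `1`-form whose value at `x` is the
differential of `log |f|`, where `ρ = f dy` with the transverse coordinate `y` of `ε x`. (`Real.log`
is the logarithm of the absolute value.) -/
noncomputable def logDerivForm (ρ : MForm (FolModel p 1) M 1)
    (ε : M → OpenPartialHomeomorph M (FolModel p 1)) : MForm (FolModel p 1) M 1 := fun x =>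
  oneForm (V := FolModel p 1)
    ((fderiv ℝ (fun y => Real.log (transCoeff ρ (ε x) ((chartAt (FolModel p 1) x).symm y)))
      (chartAt (FolModel p 1) x x)).comp (chartDeriv (chartAt (FolModel p 1) x) x))

variable {𝒜 : Set (OpenPartialHomeomorph M (FolModel p 1))}
  {ε : M → OpenPartialHomeomorph M (FolModel p 1)}

/-- In an affine atlas the form `logDerivForm` does not depend on the chosen charts: it is
`d log |f|` for each chart of the atlas. -/
theorem logDerivForm_inChart
    (hρ : ∀ (x : M) (v : TangentSpace 𝓘(ℝ, FolModel p 1) x),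
      ρ x (fun _ => v) = 0 ↔ v ∈ F.tangent x)
    (hρs : ρ.IsSmooth) (h𝒜 : ∀ e ∈ 𝒜, F.IsFoliationChart e)
    (haff : ∀ e ∈ 𝒜, ∀ e' ∈ 𝒜, ∀ z ∈ (e.symm.trans e').source,
      ∃ A : Eucl 1 →ᵃ[ℝ] Eucl 1, ∀ᶠ w in 𝓝 z, (e' (e.symm w)).2 = A w.2)
    (hε : ∀ x, ε x ∈ 𝒜 ∧ x ∈ (ε x).source) (he : e ∈ 𝒜) (c : M) {y : FolModel p 1}
    (hy : y ∈ (chartAt (FolModel p 1) c).target)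
    (hye : (chartAt (FolModel p 1) c).symm y ∈ e.source) :
    (logDerivForm ρ ε).inChart (chartAt (FolModel p 1) c) y =
      oneForm (fderiv ℝ
        (fun z => Real.log (transCoeff ρ e ((chartAt (FolModel p 1) c).symm z))) y) := by
  set φ := chartAt (FolModel p 1) c
  have hφ : φ ∈ IsManifold.maximalAtlas 𝓘(ℝ, FolModel p 1) ∞ M :=
    IsManifold.chart_mem_maximalAtlas c
  set x := φ.symm y
  set ψ := chartAt (FolModel p 1) x
  have hψ : ψ ∈ IsManifold.maximalAtlas 𝓘(ℝ, FolModel p 1) ∞ M :=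
    IsManifold.chart_mem_maximalAtlas x
  have hxψ : x ∈ ψ.source := mem_chart_source _ x
  obtain ⟨hεx, hxε⟩ := hε x
  have hcont : ContinuousAt φ.symm y := φ.symm.continuousAt hy
  -- the chain rule moves the derivative from the chart `ψ` at `x` to the chart `φ`
  have hdiff : DifferentiableAt ℝ (fun z => Real.log (transCoeff ρ (ε x) (ψ.symm z))) (ψ x) := by
    refine ((contDiffAt_transCoeff hρs (h𝒜 _ hεx).1 x (mem_chart_target _ x)
      ?_).differentiableAt (by simp)).log ?_
    · rwa [ψ.left_inv hxψ]
    · rw [ψ.left_inv hxψ]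
      exact transCoeff_ne_zero hρ (h𝒜 _ hεx) hxε
  have h1 : fderiv ℝ (fun z => Real.log (transCoeff ρ (ε x) (φ.symm z))) y =
      (fderiv ℝ (fun z => Real.log (transCoeff ρ (ε x) (ψ.symm z))) (ψ x)).comp
        (fderiv ℝ (fun z => ψ (φ.symm z)) y) := by
    rw [← fderiv_comp y hdiff ((contDiffAt_transition hφ hψ hy hxψ).differentiableAt (by simp))]
    refine EventuallyEq.fderiv_eq ?_
    filter_upwards [hcont.eventually (ψ.open_source.mem_nhds hxψ)] with z hz
    simp [ψ.left_inv hz]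
  obtain ⟨A, hA⟩ := haff _ hεx _ he (ε x x) (by simp [hxε, hye])
  obtain ⟨a, ha⟩ := exists_transCoeff_eventually_eq hρ (h𝒜 _ hεx) (h𝒜 _ he) hxε hye hA
  have ha0 : a ≠ 0 := by
    rintro rfl
    refine transCoeff_ne_zero hρ (h𝒜 _ hεx) hxε ?_
    rw [ha.self_of_nhds, mul_zero]
  have h2 : fderiv ℝ (fun z => Real.log (transCoeff ρ (ε x) (φ.symm z))) y =
      fderiv ℝ (fun z => Real.log (transCoeff ρ e (φ.symm z))) y := by
    refine Eq.trans ?_ (fderiv_add_const (Real.log a))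
    refine EventuallyEq.fderiv_eq ?_
    filter_upwards [hcont.eventually ha, hcont.eventually (e.open_source.mem_nhds hye)]
      with z hz hze
    rw [hz, Real.log_mul (transCoeff_ne_zero hρ (h𝒜 _ he) hze) ha0]
  rw [← h2, h1]
  ext v
  change fderiv ℝ _ (ψ x) (chartDeriv ψ x (chartSymmDeriv φ y (v 0))) = fderiv ℝ _ (ψ x) _
  rw [chartDeriv_chartSymmDeriv hφ hψ hy hxψ]
  rfl

theorem IsGodbillonVeyForm.isExact (hF : F.TransverselyAffine) {θ : MForm (FolModel p 1) M 3}
    (hθ : F.IsGodbillonVeyForm θ) : θ.IsExact := by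
  obtain ⟨𝒜, h𝒜, hcov, haff⟩ := hF
  obtain ⟨ρ, η, hρs, hηs, hρ, hdρ, rfl⟩ := hθ
  choose ε hε using hcov
  set κ := logDerivForm ρ ε
  have hκ := fun {e} (he : e ∈ 𝒜) c {y} hy hye =>
    logDerivForm_inChart (e := e) (y := y) hρ hρs h𝒜 haff hε he c hy hye
  have hlog (c : M) {y : FolModel p 1} (hy : y ∈ (chartAt (FolModel p 1) c).target) :
      ∃ e ∈ 𝒜, (chartAt (FolModel p 1) c).symm y ∈ e.source ∧ ContDiffAt ℝ ∞ (fun z =>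
        Real.log (transCoeff ρ e ((chartAt (FolModel p 1) c).symm z))) y ∧
      κ.inChart (chartAt (FolModel p 1) c) =ᶠ[𝓝 y] fun y => oneForm (fderiv ℝ
        (fun z => Real.log (transCoeff ρ e ((chartAt (FolModel p 1) c).symm z))) y) := by
    obtain ⟨he, hye⟩ := hε ((chartAt (FolModel p 1) c).symm y)
    refine ⟨_, he, hye, (contDiffAt_transCoeff hρs (h𝒜 _ he).1 c hy hye).log
      (transCoeff_ne_zero hρ (h𝒜 _ he) hye), ?_⟩
    filter_upwards [(chartAt (FolModel p 1) c).open_target.mem_nhds hy,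
      ((chartAt (FolModel p 1) c).symm.continuousAt hy).eventually
        ((ε _).open_source.mem_nhds hye)] with z hz hze
    exact hκ he c hz hze
  have hκs : κ.IsSmooth := by
    intro c y hy
    obtain ⟨e, -, -, hs, heq⟩ := hlog c hy
    refine ContDiffAt.contDiffWithinAt (ContDiffAt.congr_of_eventuallyEq ?_ heq)
    exact (ContinuousAlternatingMap.ofSubsingletonLIE (𝕜 := ℝ) (E := FolModel p 1) (F := ℝ)
      (0 : Fin 1)).contDiff.contDiffAt.comp y (hs.fderiv_right (m := ∞) (by simp))
  have hρ0 (x : M) : ρ.val x ≠ 0 := by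
    intro h0
    refine transCoeff_ne_zero hρ (h𝒜 _ (hε x).1) (hε x).2 ?_
    rw [transCoeff, h0]
    rfl
  have hchart (x : M) : chartAt (FolModel p 1) x ∈
      IsManifold.maximalAtlas 𝓘(ℝ, FolModel p 1) ∞ M := IsManifold.chart_mem_maximalAtlas x
  have hdiff {k : ℕ} {α : MForm (FolModel p 1) M k} (hα : α.IsSmooth) (x : M) :
      DifferentiableAt ℝ (α.inChart (chartAt (FolModel p 1) x)) (chartAt (FolModel p 1) x x) :=
    (hα.contDiffAt x (mem_chart_target _ x)).differentiableAt (by simp)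
  have hdρ' (x : M) : extDeriv (ρ.inChart (chartAt (FolModel p 1) x)) (chartAt (FolModel p 1) x x) =
      wedgeAt (η.inChart (chartAt (FolModel p 1) x) (chartAt (FolModel p 1) x x))
        (ρ.inChart (chartAt (FolModel p 1) x) (chartAt (FolModel p 1) x x)) := by
    rw [MForm.extDeriv_inChart_self, hdρ, MForm.wedge_inChart]
  -- `dρ = κ ∧ ρ`, because `ρ = f dy` and `κ = d log |f|`
  have hdρκ (x : M) :
      extDeriv (ρ.inChart (chartAt (FolModel p 1) x)) (chartAt (FolModel p 1) x x) =
      wedgeAt (κ.inChart (chartAt (FolModel p 1) x) (chartAt (FolModel p 1) x x))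
        (ρ.inChart (chartAt (FolModel p 1) x) (chartAt (FolModel p 1) x x)) := by
    have hy := mem_chart_target (FolModel p 1) x
    obtain ⟨e, he, hye, -, heq⟩ := hlog x hy
    have hcoord {z : FolModel p 1} (hz : z ∈ (chartAt (FolModel p 1) x).target)
        (hze : (chartAt (FolModel p 1) x).symm z ∈ e.source) : ContDiffAt ℝ ∞ (fun z =>
          transCoord p (e ((chartAt (FolModel p 1) x).symm z))) z :=
      (transCoord p).contDiff.contDiffAt.comp z
        (contDiffAt_transition (hchart x) (h𝒜 _ he).1 hz hze)
    have hρeq : ρ.inChart (chartAt (FolModel p 1) x) =ᶠ[𝓝 (chartAt (FolModel p 1) x x)] fun z =>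
        oneForm (transCoeff ρ e ((chartAt (FolModel p 1) x).symm z) •
          fderiv ℝ (fun z => transCoord p (e ((chartAt (FolModel p 1) x).symm z))) z) := by
      filter_upwards [(chartAt (FolModel p 1) x).open_target.mem_nhds hy,
        ((chartAt (FolModel p 1) x).symm.continuousAt hy).eventually
          (e.open_source.mem_nhds hye)] with z hz hze
      ext v
      have h1 := val_eq_transCoeff_mul hρ (h𝒜 _ he) hze
        (chartSymmDeriv (chartAt (FolModel p 1) x) z (v 0))
      rw [chartDeriv_chartSymmDeriv (hchart x) (h𝒜 _ he).1 hz hze] at h1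
      have h2 : fderiv ℝ (fun z => transCoord p (e ((chartAt (FolModel p 1) x).symm z))) z =
          (transCoord p).comp (fderiv ℝ (fun z => e ((chartAt (FolModel p 1) x).symm z)) z) :=
        ((transCoord p).hasFDerivAt.comp z ((contDiffAt_transition (hchart x) (h𝒜 _ he).1 hz
          hze).differentiableAt (by simp)).hasFDerivAt).fderiv
      rw [h2, show v = fun _ => v 0 from funext fun i => by fin_cases i; rfl]
      exact h1
    rw [hρeq.extDeriv_eq, extDeriv_oneForm_smul_fderiv
      ((contDiffAt_transCoeff hρs (h𝒜 _ he).1 x hy hye).differentiableAt (by simp))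
      (transCoeff_ne_zero hρ (h𝒜 _ he) hye) (hcoord hy hye), heq.eq_of_nhds, hρeq.eq_of_nhds]
  have hμρ (x : M) : wedgeAt (η.val x - κ.val x) (ρ.val x) = 0 := by
    have h1 := (hdρ' x).symm.trans (hdρκ x)
    have h2 := congrArg (fun τ => τ.compContinuousLinearMap
      (chartDeriv (chartAt (FolModel p 1) x) x)) h1
    simp only [wedgeAt_compContinuousLinearMap,
      MForm.inChart_compContinuousLinearMap _ (hchart x) (mem_chart_source _ x)] at h2
    rw [sub_wedgeAt, h2, sub_self]
  refine ⟨η.wedge κ, hηs.wedge hκs, funext fun x => ?_⟩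
  set φ := chartAt (FolModel p 1) x with hφ
  change (η.wedge κ).d.val x = (η.wedge η.d).val x
  obtain ⟨e, -, -, hs, heq⟩ := hlog x (mem_chart_target (FolModel p 1) x)
  have key := extDeriv_wedgeAt_eq_of_closed (hdiff hρs x) (hdiff hηs x) (hdiff hκs x)
    (fun h0 => hρ0 x ?_) (hdρ' x) (by rw [heq.extDeriv_eq, extDeriv_oneForm_fderiv hs])
    (Eventually.of_forall fun y => ?_)
  · rw [MForm.d_val, MForm.wedge_inChart, key, wedgeAt_compContinuousLinearMap,
      MForm.inChart_compContinuousLinearMap _ (hchart x) (mem_chart_source _ x)]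
    rfl
  · rw [← MForm.inChart_compContinuousLinearMap _ (hchart x) (mem_chart_source _ x), h0]
    rfl
  · have h1 := congrArg (fun τ => τ.compContinuousLinearMap (chartSymmDeriv φ y))
      (hμρ (φ.symm y))
    simp only [wedgeAt_compContinuousLinearMap] at h1
    exact h1

end CodimOne

end Foliation

theorem mainTheorem6 :
    (∀ (p q : ℕ) (M : Type*) [TopologicalSpace M] [T2Space M] [SecondCountableTopology M]
      [ChartedSpace (FolModel p q) M] [IsManifold 𝓘(ℝ, FolModel p q) ∞ M]
      (F : Foliation p q M), F.TransverselyAffine →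
      ∀ T : F.Transversal, T.IsAffine →
        (∀ (t : ℝ), ∀ f ∈ T.smoothAlg, T.modular t f ∈ T.smoothAlg) ∧
        ∀ f : Fin (q + 1) → T.Arrow → ℂ, (∀ j, f j ∈ T.smoothAlg) →
          T.FundCocycleDefined f ∧
          ∀ t : ℝ, T.fundCocycle (fun j => T.modular t (f j)) = T.fundCocycle f) ∧
    (∀ (p : ℕ) (M : Type*) [TopologicalSpace M] [T2Space M] [SecondCountableTopology M]
      [ChartedSpace (FolModel p 1) M] [IsManifold 𝓘(ℝ, FolModel p 1) ∞ M]
      (F : Foliation p 1 M), F.TransverselyAffine →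
      ∀ θ : MForm (FolModel p 1) M 3, F.IsGodbillonVeyForm θ → θ.IsExact) := by
  refine ⟨?_, ?_⟩
  · intro p q M _ _ _ _ _ F _ T hT
    exact ⟨fun t f hf => Foliation.Transversal.modular_mem_smoothAlg hT t hf, fun f hf =>
      ⟨Foliation.Transversal.fundCocycleDefined hT hf,
        Foliation.Transversal.fundCocycle_modular hT hf⟩⟩
  · intro p M _ _ _ _ _ F hF θ hθ
    exact Foliation.IsGodbillonVeyForm.isExact hF hθ
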